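/- Let $X$ be a complex Hilbert space, let $A$ be the generator of a $C_0$-semigroup $(T(t))_{t\ge 0}$ on $X$, let $U$ be a complex Banach space and $\mathcal U := L^\infty(\mathbb R_+,U)$. For $\beta\in\rho(A)$ let $X_{-1}$ be the completion of $X$ for the norm $\|(\beta I-A)^{-1}x\|_X$, let $T_{-1}(t)$ be the continuous extension of $T(t)$ to $X_{-1}$ and $A_{-1}$ the generator of $(T_{-1}(t))_{t\ge0}$. An operator $B\in L(U,X_{-1})$ is $\infty$-admissible if $\int_0^t T_{-1}(t-s)Bu(s)\,ds\in X$ for all $t\ge 0$ and $u\in\mathcal U$; then $\phi(t,x,u):=T(t)x+\int_0^tT_{-1}(t-s)Bu(s)\,ds\in X$ denotes the mild solution of $\dot x=Ax+Bu$, $x(0)=x$. Let $P\in L(X)$ satisfy: (i) $\operatorname{Re}\langle Px,x\rangle>0$ for all $x\in X\setminus\{0\}$; (ii) $\operatorname{im}P\subset D(A^*)$; (iii) $PA$ extends to a bounded operator on $X$, also denoted $PA$; (iv) $\operatorname{Re}\langle (PA+A^*P)x,x\rangle\le-\|x\|^2$ for all $x\in D(A)$. Then $(T(t))$ is exponentially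 stable, i.e. $\|T(t)\|\le Me^{-\omega t}$ for all $t\ge0$ with some $M,\omega>0$; moreover $0\in\rho(A)$, $A^*P\in L(X)$, and for every $\beta\in\rho(A)$ the operator $A_{-1}$ has a bounded inverse $A_{-1}^{-1}\in L(X_{-1},X)$. For every $\infty$-admissible $B\in L(U,X_{-1})$: (a) $V(x):=\operatorname{Re}\langle Px,x\rangle$ is a non-coercive ISS Lyapunov function for $\dot x=Ax+Bu$. That is, $V:X\to\mathbb R_+$ is continuous and there are $\psi_2,\alpha\in\mathcal K_\infty$, $\sigma\in\mathcal K$ with $0<V(x)\le\psi_2(\|x\|)$ for $x\ne0$ and $\dot V_u(x)\le-\alpha(\|x\|)+\sigma(\|u\|_\infty)$ for all $x\in X$, $u\in\mathcal U$, where $\dot V_u(x):=\limsup_{t\searrow0}\frac1t\big(V(\phi(t,x,u))-V(x)\big)$. (b) For each $t>0$ there is a smallest constant $\kappa(t)\ge0$ with $\big\|\int_0^tT_{-1}(t-s)Bu(s)\,ds\big\|_X\le\kappa(t)\|u\|_\infty$ for all $u\in L^\infty([0,t),U)$; the limit $\kappa(0):=\lim_{t\searrow0}\kappa(t)$ exists;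 and for all $M,\omega>0$ with $\|T(t)\|\le Me^{-\omega t}$ ($t\ge0$), all $\varepsilon>0$, $x\in X$ and $u\in\mathcal U$, $$\dot V_u(x)\le(\varepsilon-1)\|x\|^2+c(\varepsilon)\|u\|_\infty^2,$$ $$c(\varepsilon)=\frac1{4\varepsilon}\big(\|A^*P\|+\|PA\|\big)^2\|A_{-1}^{-1}B\|_{L(U,X)}^2M^2+M\|A^*P\|\,\|A_{-1}^{-1}B\|_{L(U,X)}\,\kappa(0).$$ (c) The system is input-to-state stable (ISS): there are $\beta\in\mathcal{KL}$ and $\gamma\in\mathcal K$ with $\|\phi(t,x,u)\|\le\beta(\|x\|,t)+\gamma(\|u\|_\infty)$ for all $t\ge0$, $x\in X$, $u\in\mathcal U$. (d) If in addition all mild solutions $t\mapsto\phi(t,x,u)\in X$ ($x\in X$, $u\in\mathcal U$) are continuous, then $(X,\mathcal U,\phi)$ is a forward complete control system: $\phi(0,x,u)=x$; $\phi(t,x,u)$ depends only on $u|_{[0,t]}$; $t\mapsto\phi(t,x,u)$ is continuous; and $\phi(h,\phi(t,x,u),u(t+\cdot))=\phi(t+h,x,u)$ for $t,h\ge0$.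 -/

import Mathlib

open MeasureTheory Filter Topology Set
open scoped NNReal ENNReal LinearPMap

noncomputable section

namespace NoncoerciveISS

/-! ### Comparison functions -/

/-- Class `K`: continuous, strictly increasing functions on `[0, ∞)` vanishing at `0`. -/
def IsClassK (γ : ℝ≥0 → ℝ≥0) : Prop :=
  Continuous γ ∧ StrictMono γ ∧ γ 0 = 0

/-- Class `K∞`: unbounded functions of class `K`. -/
def IsClassKInf (γ : ℝ≥0 → ℝ≥0) : Prop :=
  IsClassK γ ∧ ¬ BddAbove (range γ)

/-- Class `L`: continuous, strictly decreasing functions on `[0, ∞)` tending to `0` at infinity. -/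
def IsClassL (γ : ℝ≥0 → ℝ≥0) : Prop :=
  Continuous γ ∧ StrictAnti γ ∧ Tendsto γ atTop (𝓝 0)

/-- Class `KL`. -/
def IsClassKL (β : ℝ≥0 → ℝ≥0 → ℝ≥0) : Prop :=
  (∀ t, IsClassK (fun r => β r t)) ∧ ∀ r, 0 < r → IsClassL (β r)

/-! ### Control systems with inputs in `L^∞` -/

/-- The input space `L^∞(ℝ₊, U)`. -/
abbrev LInf (U : Type*) [NormedAddCommGroup U] : Type _ :=
  Lp U ∞ (volume.restrict (Ici (0 : ℝ)))

section Systems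

variable {X U : Type*} [NormedAddCommGroup X] [NormedAddCommGroup U]

/-- The axioms of a forward complete control system for a transition map with inputs in
`L^∞(ℝ₊, U)`; in the cocycle property `v` is the shifted input `u(t + ·)`. -/
structure IsForwardComplete (φ : ℝ≥0 → X → LInf U → X) : Prop where
  identity : ∀ x u, φ 0 x u = x
  causality : ∀ (t : ℝ≥0) (x : X) (u v : LInf U),
    u =ᵐ[volume.restrict (Icc (0 : ℝ) t)] v → φ t x u = φ t x v
  continuity : ∀ x u, Continuous (fun t => φ t x u)
  cocycle : ∀ (t h : ℝ≥0) (x : X) (u v : LInf U),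
    v =ᵐ[volume.restrict (Ici (0 : ℝ))] (fun s => u ((t : ℝ) + s)) →
      φ h (φ t x u) v = φ (t + h) x u

/-- Input-to-state stability estimate for a transition map. -/
def IsISS (φ : ℝ≥0 → X → LInf U → X) : Prop :=
  ∃ (β : ℝ≥0 → ℝ≥0 → ℝ≥0) (γ : ℝ≥0 → ℝ≥0), IsClassKL β ∧ IsClassK γ ∧
    ∀ (t : ℝ≥0) (x : X) (u : LInf U), ‖φ t x u‖₊ ≤ β ‖x‖₊ t + γ ‖u‖₊

/-- The right-hand upper Dini derivative of `V` at `x` along the trajectory with input `u`,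
as an extended real number. -/
def diniDeriv (φ : ℝ≥0 → X → LInf U → X) (V : X → ℝ) (u : LInf U) (x : X) : EReal :=
  limsup (fun t : ℝ≥0 => (((V (φ t x u) - V x) / (t : ℝ) : ℝ) : EReal)) (𝓝[>] 0)

/-- Non-coercive ISS Lyapunov functions. -/
def IsNoncoerciveISSLyapunov (φ : ℝ≥0 → X → LInf U → X) (V : X → ℝ) : Prop :=
  Continuous V ∧ (∀ x, 0 ≤ V x) ∧
    ∃ ψ α σ : ℝ≥0 → ℝ≥0, IsClassKInf ψ ∧ IsClassKInf α ∧ IsClassK σ ∧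
      (∀ x, x ≠ 0 → 0 < V x ∧ V x ≤ ψ ‖x‖₊) ∧
      ∀ (x : X) (u : LInf U),
        diniDeriv φ V u x ≤ ((-(α ‖x‖₊ : ℝ) + (σ ‖u‖₊ : ℝ) : ℝ) : EReal)

end Systems

/-! ### Semigroups, generators and resolvents -/

section Semigroups

variable {E : Type*} [NormedAddCommGroup E] [NormedSpace ℂ E]

/-- `T` is a strongly continuous semigroup of bounded operators. -/
structure IsC0Semigroup (T : ℝ≥0 → E →L[ℂ] E) : Prop where
  map_zero : T 0 = ContinuousLinearMap.id ℂ E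
  map_add : ∀ s t, T (s + t) = (T s).comp (T t)
  strong_cont : ∀ x, Continuous (fun t => T t x)

/-- The difference quotients whose limit as `t → 0+` defines the generator. -/
def diffQuot (T : ℝ≥0 → E →L[ℂ] E) (x : E) (t : ℝ≥0) : E :=
  (((t : ℝ) : ℂ))⁻¹ • (T t x - x)

/-- The infinitesimal generator of `T`: its domain consists of all `x` for which
`(T t x - x) / t` converges as `t → 0+`, and its value at `x` is this limit. -/
def generator (T : ℝ≥0 → E →L[ℂ] E) : E →ₗ.[ℂ] E where
  domain :=
    { carrier := {x | ∃ y, Tendsto (diffQuot T x) (𝓝[>] 0) (𝓝 y)}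
      zero_mem' := ⟨0, by
        have h : diffQuot T (0 : E) = fun _ => 0 := by
          funext t
          simp [diffQuot]
        rw [h]
        exact tendsto_const_nhds⟩
      add_mem' := by
        rintro a b ⟨y, hy⟩ ⟨z, hz⟩
        refine ⟨y + z, (hy.add hz).congr fun t => ?_⟩
        simp only [diffQuot, map_add, ← smul_add]
        congr 1
        abel
      smul_mem' := by
        rintro c a ⟨y, hy⟩
        refine ⟨c • y, (hy.const_smul c).congr fun t => ?_⟩
        simp only [diffQuot, map_smul, ← smul_sub]
        rw [smul_comm] }
  toFun :=
    { toFun := fun x => x.2.choose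
      map_add' := by
        intro a b
        refine tendsto_nhds_unique (a + b).2.choose_spec
          ((a.2.choose_spec.add b.2.choose_spec).congr fun t => ?_)
        simp only [diffQuot, Submodule.coe_add, map_add, ← smul_add]
        congr 1
        abel
      map_smul' := by
        intro c a
        refine tendsto_nhds_unique (c • a).2.choose_spec
          ((a.2.choose_spec.const_smul c).congr fun t => ?_)
        simp only [diffQuot, Submodule.coe_smul, map_smul, ← smul_sub]
        rw [smul_comm] }

theorem mem_generator_domain (T : ℝ≥0 → E →L[ℂ] E) (x : E) :
    x ∈ (generator T).domain ↔ ∃ y, Tendsto (diffQuot T x) (𝓝[>] 0) (𝓝 y) :=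
  Iff.rfl

theorem generator_apply_tendsto (T : ℝ≥0 → E →L[ℂ] E) (x : (generator T).domain) :
    Tendsto (diffQuot T x) (𝓝[>] 0) (𝓝 (generator T x)) :=
  x.2.choose_spec

/-- `R` is the bounded two-sided inverse of `β - A`. -/
def IsResolventAt (A : E →ₗ.[ℂ] E) (β : ℂ) (R : E →L[ℂ] E) : Prop :=
  (∀ y, ∃ h : R y ∈ A.domain, β • R y - A ⟨R y, h⟩ = y) ∧
    ∀ x : A.domain, R (β • (x : E) - A x) = x

/-- The resolvent set `ρ(A)`. -/
def genResolventSet (A : E →ₗ.[ℂ] E) : Set ℂ :=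
  {β | ∃ R, IsResolventAt A β R}

open scoped Classical in
/-- The resolvent `(β - A)⁻¹` for `β ∈ ρ(A)` (and `0` otherwise). -/
def genResolvent (A : E →ₗ.[ℂ] E) (β : ℂ) : E →L[ℂ] E :=
  if h : ∃ R, IsResolventAt A β R then h.choose else 0

theorem isResolventAt_genResolvent {A : E →ₗ.[ℂ] E} {β : ℂ} (h : β ∈ genResolventSet A) :
    IsResolventAt A β (genResolvent A β) := by
  have h' : ∃ R, IsResolventAt A β R := h
  rw [genResolvent, dif_pos h']
  exact h'.choose_spec

/-! ### The extrapolation space `X₋₁` and the extrapolated semigroup `T₋₁` -/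

/-- The space `X` equipped with the norm `x ↦ ‖(β - A)⁻¹ x‖`. -/
def PreExtrapolation (_A : E →ₗ.[ℂ] E) (_β : ℂ) : Type _ := E

instance (A : E →ₗ.[ℂ] E) (β : ℂ) : AddCommGroup (PreExtrapolation A β) :=
  inferInstanceAs (AddCommGroup E)

instance (A : E →ₗ.[ℂ] E) (β : ℂ) : Module ℂ (PreExtrapolation A β) :=
  inferInstanceAs (Module ℂ E)

/-- The resolvent, seen as a map out of `PreExtrapolation A β`. -/
def preResolvent (A : E →ₗ.[ℂ] E) (β : ℂ) : PreExtrapolation A β →ₗ[ℂ] E :=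
  (genResolvent A β).toLinearMap

instance (A : E →ₗ.[ℂ] E) (β : ℂ) : SeminormedAddCommGroup (PreExtrapolation A β) :=
  SeminormedAddCommGroup.induced (PreExtrapolation A β) E (preResolvent A β)

instance (A : E →ₗ.[ℂ] E) (β : ℂ) : NormedSpace ℂ (PreExtrapolation A β) :=
  NormedSpace.induced ℂ (PreExtrapolation A β) E (preResolvent A β)

/-- The extrapolation space `X₋₁`: the completion of `X` for the norm `x ↦ ‖(β - A)⁻¹ x‖`. -/
def Extrapolation (A : E →ₗ.[ℂ] E) (β : ℂ) : Type _ :=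
  UniformSpace.Completion (PreExtrapolation A β)

instance (A : E →ₗ.[ℂ] E) (β : ℂ) : NormedAddCommGroup (Extrapolation A β) :=
  inferInstanceAs (NormedAddCommGroup (UniformSpace.Completion (PreExtrapolation A β)))

instance (A : E →ₗ.[ℂ] E) (β : ℂ) : NormedSpace ℂ (Extrapolation A β) :=
  inferInstanceAs (NormedSpace ℂ (UniformSpace.Completion (PreExtrapolation A β)))

instance (A : E →ₗ.[ℂ] E) (β : ℂ) : CompleteSpace (Extrapolation A β) :=
  inferInstanceAs (CompleteSpace (UniformSpace.Completion (PreExtrapolation A β)))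

/-- The canonical map `X → X₋₁`. -/
def extrapIncl (A : E →ₗ.[ℂ] E) (β : ℂ) : E →ₗ[ℂ] Extrapolation A β where
  toFun x := ((show PreExtrapolation A β from x : PreExtrapolation A β) :
    UniformSpace.Completion (PreExtrapolation A β))
  map_add' x y := UniformSpace.Completion.coe_add (α := PreExtrapolation A β) x y
  map_smul' c x := UniformSpace.Completion.coe_smul (X := PreExtrapolation A β) c x

theorem norm_extrapIncl (A : E →ₗ.[ℂ] E) (β : ℂ) (x : E) :
    ‖extrapIncl A β x‖ = ‖genResolvent A β x‖ :=
  UniformSpace.Completion.norm_coe (E := PreExtrapolation A β) x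

theorem denseRange_extrapIncl (A : E →ₗ.[ℂ] E) (β : ℂ) : DenseRange (extrapIncl A β) :=
  UniformSpace.Completion.denseRange_coe (α := PreExtrapolation A β)

/-- The semigroup `T₋₁` on `X₋₁`: the continuous extension of `T`. -/
def extrapSemigroup (T : ℝ≥0 → E →L[ℂ] E) (β : ℂ) (t : ℝ≥0) :
    Extrapolation (generator T) β →L[ℂ] Extrapolation (generator T) β :=
  ((extrapIncl (generator T) β).comp (T t).toLinearMap).extendOfNorm (extrapIncl (generator T) β)

/-- The resolvent commutes with the semigroup. -/
theorem genResolvent_comm {T : ℝ≥0 → E →L[ℂ] E} (hT : IsC0Semigroup T) {β : ℂ}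
    (hβ : β ∈ genResolventSet (generator T)) (t : ℝ≥0) (x : E) :
    genResolvent (generator T) β (T t x) = T t (genResolvent (generator T) β x) := by
  obtain ⟨h1, h2⟩ := isResolventAt_genResolvent hβ
  set R := genResolvent (generator T) β
  obtain ⟨hy, hyx⟩ := h1 x
  have hlim : Tendsto (diffQuot T (T t (R x))) (𝓝[>] 0)
      (𝓝 (T t (generator T ⟨R x, hy⟩))) := by
    have h := ((T t).continuous.tendsto _).comp (generator_apply_tendsto T ⟨R x, hy⟩)
    refine h.congr fun s => ?_
    have hc : T t (T s (R x)) = T s (T t (R x)) := by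
      have e1 := congrArg (fun L => L (R x)) (hT.map_add t s)
      have e2 := congrArg (fun L => L (R x)) (hT.map_add s t)
      simp only [ContinuousLinearMap.comp_apply] at e1 e2
      rw [← e1, ← e2, add_comm]
    simp only [Function.comp, diffQuot, map_smul, map_sub, hc]
  have hmem : T t (R x) ∈ (generator T).domain := ⟨_, hlim⟩
  have hval : generator T ⟨T t (R x), hmem⟩ = T t (generator T ⟨R x, hy⟩) :=
    tendsto_nhds_unique (generator_apply_tendsto T ⟨T t (R x), hmem⟩) hlim
  have h : R (β • T t (R x) - generator T ⟨T t (R x), hmem⟩) = T t (R x) := h2 ⟨T t (R x), hmem⟩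
  rwa [hval, ← map_smul, ← map_sub, hyx] at h

/-- `T₋₁` extends `T`. -/
theorem extrapSemigroup_incl {T : ℝ≥0 → E →L[ℂ] E} (hT : IsC0Semigroup T) {β : ℂ}
    (hβ : β ∈ genResolventSet (generator T)) (t : ℝ≥0) (x : E) :
    extrapSemigroup T β t (extrapIncl (generator T) β x) =
      extrapIncl (generator T) β (T t x) := by
  refine LinearMap.extendOfNorm_eq (denseRange_extrapIncl _ _) ⟨‖T t‖, fun y => ?_⟩ x
  simp only [LinearMap.comp_apply, ContinuousLinearMap.coe_coe, norm_extrapIncl]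
  rw [genResolvent_comm hT hβ]
  exact (T t).le_opNorm _

/-- `J : X₋₁ → X` is the bounded inverse of the generator `A₋₁` of `T₋₁`, whose domain is `X`. -/
def IsExtrapInverse (T : ℝ≥0 → E →L[ℂ] E) (β : ℂ)
    (J : Extrapolation (generator T) β →L[ℂ] E) : Prop :=
  (∀ z, ∃ h : extrapIncl (generator T) β (J z) ∈ (generator (extrapSemigroup T β)).domain,
      generator (extrapSemigroup T β) ⟨extrapIncl (generator T) β (J z), h⟩ = z) ∧
    ∀ z : (generator (extrapSemigroup T β)).domain,
      extrapIncl (generator T) β (J (generator (extrapSemigroup T β) z)) = z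

/-! ### The linear system `x' = A x + B u` -/

variable {U : Type*} [NormedAddCommGroup U] [NormedSpace ℂ U]

/-- The integral `∫₀ᵗ T₋₁(t - s) B u(s) ds` in `X₋₁`. -/
def inputConv (T : ℝ≥0 → E →L[ℂ] E) (β : ℂ) (B : U →L[ℂ] Extrapolation (generator T) β)
    (t : ℝ≥0) (u : ℝ → U) : Extrapolation (generator T) β :=
  ∫ s in (0 : ℝ)..t, extrapSemigroup T β (Real.toNNReal ((t : ℝ) - s)) (B (u s))

/-- `∞`-admissibility of the control operator `B ∈ L(U, X₋₁)`. -/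
def IsInfAdmissible (T : ℝ≥0 → E →L[ℂ] E) (β : ℂ)
    (B : U →L[ℂ] Extrapolation (generator T) β) : Prop :=
  ∀ (t : ℝ≥0) (u : LInf U), ∃ y : E, extrapIncl (generator T) β y = inputConv T β B t u

/-- The mild solution `φ(t, x, u) = T(t) x + ∫₀ᵗ T₋₁(t - s) B u(s) ds`, as an element of `X`. -/
def mildSolution (T : ℝ≥0 → E →L[ℂ] E) (β : ℂ) (B : U →L[ℂ] Extrapolation (generator T) β)
    (hB : IsInfAdmissible T β B) (t : ℝ≥0) (x : E) (u : LInf U) : E :=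
  T t x + (hB t u).choose

/-- `k ≥ 0` bounds the map `u ↦ ∫₀ᵗ T₋₁(t - s) B u(s) ds` from `L^∞([0, t), U)` to `X`. -/
def IsInputBound (T : ℝ≥0 → E →L[ℂ] E) (β : ℂ) (B : U →L[ℂ] Extrapolation (generator T) β)
    (t : ℝ≥0) (k : ℝ) : Prop :=
  0 ≤ k ∧ ∀ u : Lp U ∞ (volume.restrict (Ico (0 : ℝ) t)),
    ∃ y : E, extrapIncl (generator T) β y = inputConv T β B t u ∧ ‖y‖ ≤ k * ‖u‖

end Semigroups

end NoncoerciveISS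

end

open NoncoerciveISS

/-! Stability comes from a Datko argument. Along an orbit, `V(T(t)x) - V(x)` is the integral of the
quadratic form of `PA + A*P` (`re_inner_orbit_sub`). That form is at most `-‖·‖²` and `V ≥ 0`, so
`∫₀ᵗ ‖T(s)x‖² ds ≤ ‖P‖ ‖x‖²`, without any coercivity of `P`. Square integrability of all orbits
gives some `τ > 0` with `‖T(τ)‖ ≤ 1/2`, hence exponential decay, and `1 - T(τ)` is invertible, which
puts `0` in `ρ(A)`.

The extrapolation space is removed by an isometry. The resolvent `R = (β - A)⁻¹` extends to an
isometry `Λ` of `X₋₁` onto `X` that intertwines `T₋₁` with `T`. A vector `z ∈ X` is therefore the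
value of the input integral exactly when `R z` is the convolution of `T` with the bounded operator
`Λ B` (`incl_eq_inputConv_iff`). Since `R` is injective, identities and closed graph arguments in
`X` can be checked after applying `R`; in particular the input map `L^∞([0,t),U) → X` is bounded,
and `κ(t)` is its norm.

For the dissipation inequality, write the input contribution `z` to the mild solution as `A w` with
`w = A⁻¹ z`. Then `w` is a convolution with the bounded operator `A₋₁⁻¹B`, so `‖w‖ ≤ M ‖A₋₁⁻¹B‖ ‖u‖
t`, although `z` itself need not be small. In `V(T(t)x + A w)` every term involving `A w` can be
turned into a pairing with `w` through `PA` or `A*P`, which supplies the factor `t` needed in the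
Dini derivative. The term quadratic in `A w` keeps one factor `‖z‖ ≤ κ(t) ‖u‖`, whence `κ(0)`;
Young's inequality yields `c(ε)`.

ISS does not go through `V`: it follows from exponential decay of `T` and boundedness of `κ` on the
half-line. -/

namespace NoncoerciveISS

/-! ### Orbits, orbit integrals and the generator. -/

section Semigroups

variable {E : Type*} [NormedAddCommGroup E] [NormedSpace ℂ E]

theorem tendsto_coe_nhdsGT_zero :
    Tendsto (fun t : ℝ≥0 => (t : ℝ)) (𝓝[>] 0) (𝓝[>] (0 : ℝ)) := by
  refine tendsto_nhdsWithin_iff.2 ⟨?_, ?_⟩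
  · exact (NNReal.continuous_coe.tendsto 0).mono_left nhdsWithin_le_nhds
  · filter_upwards [self_mem_nhdsWithin] with t ht
    exact NNReal.coe_pos.2 ht

theorem tendsto_toNNReal_sub (s : ℝ) :
    Tendsto (fun r : ℝ => (r - s).toNNReal) (𝓝[>] s) (𝓝[>] 0) := by
  refine tendsto_nhdsWithin_iff.2 ⟨?_, ?_⟩
  · have h : Continuous fun r : ℝ => (r - s).toNNReal := by fun_prop
    simpa using (h.tendsto s).mono_left nhdsWithin_le_nhds
  · filter_upwards [self_mem_nhdsWithin] with r hr
    exact Real.toNNReal_pos.2 (sub_pos.2 hr)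

/-- Averages of a continuous function over shrinking intervals converge. -/
theorem tendsto_average {F : Type*} [NormedAddCommGroup F] [NormedSpace ℝ F] [CompleteSpace F]
    {f : ℝ → F} (hf : Continuous f) :
    Tendsto (fun t : ℝ≥0 => (t : ℝ)⁻¹ • ∫ s in (0 : ℝ)..t, f s) (𝓝[>] 0) (𝓝 (f 0)) := by
  have h : HasDerivWithinAt (fun u => ∫ s in (0 : ℝ)..u, f s) (f 0) (Ioi 0) 0 :=
    (hf.integral_hasStrictDerivAt 0 0).hasDerivAt.hasDerivWithinAt
  rw [hasDerivWithinAt_iff_tendsto_slope' (by simp)] at h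
  refine (h.comp tendsto_coe_nhdsGT_zero).congr fun t => ?_
  simp [slope_def_module]

theorem diffQuot_eq_real_smul (T : ℝ≥0 → E →L[ℂ] E) (x : E) (t : ℝ≥0) :
    diffQuot T x t = (t : ℝ)⁻¹ • (T t x - x) := by
  rw [diffQuot, ← Complex.ofReal_inv, Complex.coe_smul]

theorem generator_of_tendsto {T : ℝ≥0 → E →L[ℂ] E} {x y : E}
    (h : Tendsto (diffQuot T x) (𝓝[>] 0) (𝓝 y)) :
    ∃ hx : x ∈ (generator T).domain, generator T ⟨x, hx⟩ = y :=
  ⟨⟨y, h⟩, tendsto_nhds_unique (generator_apply_tendsto T ⟨x, ⟨y, h⟩⟩) h⟩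

/-- Bounded operators that commute with the semigroup commute with its generator. -/
theorem generator_of_commute {T : ℝ≥0 → E →L[ℂ] E} {L : E →L[ℂ] E}
    (hL : ∀ t x, L (T t x) = T t (L x)) (x : (generator T).domain) :
    ∃ hx : L x ∈ (generator T).domain, generator T ⟨L x, hx⟩ = L (generator T x) := by
  refine generator_of_tendsto
    (((L.continuous.tendsto _).comp (generator_apply_tendsto T x)).congr fun t => ?_)
  simp only [Function.comp, diffQuot, map_smul, map_sub, hL]

/-- The integral `∫₀ᵗ T(s) x ds`. -/
noncomputable def orbitIntegral (T : ℝ≥0 → E →L[ℂ] E) (t : ℝ≥0) (x : E) : E :=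
  ∫ s in (0 : ℝ)..t, T s.toNNReal x

namespace IsC0Semigroup

variable {T : ℝ≥0 → E →L[ℂ] E} (hT : IsC0Semigroup T)
include hT

theorem zero_apply (x : E) : T 0 x = x := by simp [hT.map_zero]

theorem add_apply (s t : ℝ≥0) (x : E) : T (s + t) x = T s (T t x) := by simp [hT.map_add]

theorem comm (s t : ℝ≥0) (x : E) : T s (T t x) = T t (T s x) := by
  rw [← hT.add_apply, add_comm, hT.add_apply]

theorem continuous_orbit (x : E) : Continuous fun s : ℝ => T s.toNNReal x :=
  (hT.strong_cont x).comp continuous_real_toNNReal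

theorem intervalIntegrable_orbit (x : E) (a b : ℝ) :
    IntervalIntegrable (fun s : ℝ => T s.toNNReal x) volume a b :=
  (hT.continuous_orbit x).intervalIntegrable a b

/-- The generator is a one-sided limit, so only a right derivative is immediate. With continuity of
the orbit this suffices for the fundamental theorem of calculus. -/
theorem hasDerivWithinAt_orbit {x y : E} (h : Tendsto (diffQuot T x) (𝓝[>] 0) (𝓝 y))
    {s : ℝ} (hs : 0 ≤ s) :
    HasDerivWithinAt (fun r : ℝ => T r.toNNReal x) (T s.toNNReal y) (Ioi s) s := by
  rw [hasDerivWithinAt_iff_tendsto_slope' (by simp)]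
  refine ((((T s.toNNReal).continuous.tendsto y).comp h).comp
    (tendsto_toNNReal_sub s)).congr' ?_
  filter_upwards [self_mem_nhdsWithin] with r hr
  have hr' : 0 ≤ r - s := sub_nonneg.2 (le_of_lt hr)
  have hsum : r.toNNReal = s.toNNReal + (r - s).toNNReal := by
    rw [← Real.toNNReal_add hs hr', add_sub_cancel]
  simp only [Function.comp, diffQuot, slope_def_module, map_smul, map_sub, Real.coe_toNNReal _ hr',
    hsum, hT.add_apply]
  rw [← Complex.ofReal_inv, Complex.coe_smul]

variable [CompleteSpace E]

theorem exists_norm_le (τ : ℝ≥0) : ∃ K : ℝ, 0 < K ∧ ∀ t ≤ τ, ‖T t‖ ≤ K := by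
  obtain ⟨K, hK⟩ := banach_steinhaus (g := fun t : Icc (0 : ℝ≥0) τ => T t) fun x => by
    obtain ⟨C, hC⟩ := (isCompact_Icc (a := (0 : ℝ≥0)) (b := τ)).exists_bound_of_continuousOn
      (hT.strong_cont x).continuousOn
    exact ⟨C, fun t => hC t t.2⟩
  exact ⟨max K 1, by positivity, fun t ht => (hK ⟨t, zero_le, ht⟩).trans (le_max_left _ _)⟩

/-- Local uniform boundedness upgrades strong continuity to joint continuity. This gives
measurability of convolution integrands and continuity in `x` of orbit integrals. -/
theorem continuous_uncurry : Continuous fun p : ℝ≥0 × E => T p.1 p.2 := by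
  rw [continuous_iff_continuousAt]
  rintro ⟨t₀, x₀⟩
  obtain ⟨K, hK0, hK⟩ := hT.exists_norm_le (t₀ + 1)
  have hlim : Tendsto (fun p : ℝ≥0 × E => K * ‖p.2 - x₀‖ + ‖T p.1 x₀ - T t₀ x₀‖)
      (𝓝 (t₀, x₀)) (𝓝 0) := by
    have hc : Continuous fun p : ℝ≥0 × E => K * ‖p.2 - x₀‖ + ‖T p.1 x₀ - T t₀ x₀‖ := by
      have h : Continuous fun p : ℝ≥0 × E => T p.1 x₀ := (hT.strong_cont x₀).comp continuous_fst
      exact (continuous_const.mul (continuous_snd.sub continuous_const).norm).add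
        (h.sub continuous_const).norm
    simpa using hc.tendsto (t₀, x₀)
  refine tendsto_iff_norm_sub_tendsto_zero.2 (squeeze_zero' (.of_forall fun _ => norm_nonneg _)
    ?_ hlim)
  have hev : ∀ᶠ p : ℝ≥0 × E in 𝓝 (t₀, x₀), p.1 < t₀ + 1 :=
    continuous_fst.continuousAt.eventually_lt_const (lt_add_one t₀)
  filter_upwards [hev] with p hp
  have : T p.1 p.2 - T t₀ x₀ = T p.1 (p.2 - x₀) + (T p.1 x₀ - T t₀ x₀) := by
    rw [map_sub]; abel
  rw [this]
  refine (norm_add_le _ _).trans ?_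
  gcongr
  exact ((T p.1).le_opNorm _).trans (by gcongr; exact hK _ hp.le)

theorem continuous_orbit_uncurry : Continuous fun p : E × ℝ => T p.2.toNNReal p.1 :=
  hT.continuous_uncurry.comp
    ((continuous_real_toNNReal.comp continuous_snd).prodMk continuous_fst)

theorem map_orbitIntegral {L : E →L[ℂ] E} (hL : ∀ t x, L (T t x) = T t (L x)) (t : ℝ≥0) (x : E) :
    L (orbitIntegral T t x) = orbitIntegral T t (L x) := by
  rw [orbitIntegral, ← L.intervalIntegral_comp_comm (hT.intervalIntegrable_orbit x 0 t)]
  simp only [hL, orbitIntegral]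

/-- `x ↦ ∫₀ᵗ T(s) x ds` as a bounded operator. -/
noncomputable def orbitIntegralCLM (t : ℝ≥0) : E →L[ℂ] E where
  toFun := orbitIntegral T t
  map_add' x y := by
    simp only [orbitIntegral, _root_.map_add]
    exact intervalIntegral.integral_add (hT.intervalIntegrable_orbit x 0 t)
      (hT.intervalIntegrable_orbit y 0 t)
  map_smul' c x := by
    simp only [orbitIntegral, map_smul, RingHom.id_apply]
    exact intervalIntegral.integral_smul c _
  cont := intervalIntegral.continuous_parametric_intervalIntegral_of_continuous'
    (f := fun x s => T s.toNNReal x) hT.continuous_orbit_uncurry 0 t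

theorem orbitIntegralCLM_apply (t : ℝ≥0) (x : E) :
    hT.orbitIntegralCLM t x = orbitIntegral T t x := rfl

theorem tendsto_average_orbit (x : E) :
    Tendsto (fun t : ℝ≥0 => (t : ℝ)⁻¹ • orbitIntegral T t x) (𝓝[>] 0) (𝓝 x) := by
  simpa [hT.zero_apply, orbitIntegral] using tendsto_average (hT.continuous_orbit x)

/-- After shifting variables both sides are differences of integrals of one function, and `∫₀ʰ +
∫ₕʰ⁺ᵗ = ∫₀ᵗ + ∫ₜᵗ⁺ʰ`. -/
theorem apply_orbitIntegral_sub (t h : ℝ≥0) (x : E) :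
    T h (orbitIntegral T t x) - orbitIntegral T t x = orbitIntegral T h (T t x - x) := by
  have key : ∀ a b : ℝ≥0, T a (orbitIntegral T b x) = ∫ s in (a : ℝ)..(a + b : ℝ),
      T s.toNNReal x := by
    intro a b
    rw [orbitIntegral, ← (T a).intervalIntegral_comp_comm (hT.intervalIntegrable_orbit x 0 b)]
    have := intervalIntegral.integral_comp_add_left (a := 0) (b := b)
      (fun s : ℝ => T s.toNNReal x) a
    rw [add_zero] at this
    rw [← this]
    refine intervalIntegral.integral_congr fun s hs => ?_
    rw [uIcc_of_le (NNReal.coe_nonneg b)] at hs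
    simp only [Real.toNNReal_add (NNReal.coe_nonneg a) hs.1, Real.toNNReal_coe, hT.add_apply]
  have hint := hT.intervalIntegrable_orbit x
  have hsub : orbitIntegral T h (T t x - x) =
      T t (orbitIntegral T h x) - orbitIntegral T h x := by
    rw [hT.map_orbitIntegral (fun s y => hT.comm t s y)]
    exact (hT.orbitIntegralCLM h).map_sub _ _
  rw [hsub, key, key, orbitIntegral, orbitIntegral, sub_eq_sub_iff_add_eq_add, add_comm,
    intervalIntegral.integral_add_adjacent_intervals (hint _ _) (hint _ _), add_comm (∫ _ in _.._, _),
    intervalIntegral.integral_add_adjacent_intervals (hint _ _) (hint _ _), add_comm (h : ℝ)]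

theorem generator_orbitIntegral (t : ℝ≥0) (x : E) :
    ∃ h : orbitIntegral T t x ∈ (generator T).domain,
      generator T ⟨orbitIntegral T t x, h⟩ = T t x - x := by
  refine generator_of_tendsto ((hT.tendsto_average_orbit (T t x - x)).congr fun h => ?_)
  rw [diffQuot_eq_real_smul, hT.apply_orbitIntegral_sub]

theorem orbitIntegral_generator (t : ℝ≥0) (x : (generator T).domain) :
    orbitIntegral T t (generator T x) = T t x - x := by
  have := intervalIntegral.integral_eq_sub_of_hasDeriv_right_of_le t.2
    (hT.continuous_orbit (x : E)).continuousOn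
    (fun s hs => hT.hasDerivWithinAt_orbit (generator_apply_tendsto T x) hs.1.le)
    (hT.intervalIntegrable_orbit _ 0 t)
  simpa [hT.zero_apply, orbitIntegral] using this

theorem dense_domain : Dense ((generator T).domain : Set E) := fun x => by
  refine mem_closure_of_tendsto (hT.tendsto_average_orbit x) (.of_forall fun t => ?_)
  exact (generator T).domain.smul_of_tower_mem _ (hT.generator_orbitIntegral t x).1

/-- If some `T(τ)` is a strict contraction, then `0` lies in the resolvent set. -/
theorem zero_mem_genResolventSet {τ : ℝ≥0} (hτ : ‖T τ‖ < 1) :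
    (0 : ℂ) ∈ genResolventSet (generator T) := by
  obtain ⟨N, hN⟩ := isUnit_one_sub_of_norm_lt_one hτ
  set L : E →L[ℂ] E := ((N⁻¹ : (E →L[ℂ] E)ˣ) : E →L[ℂ] E) with hLdef
  have h1 : ∀ x, L (T τ x - x) = -x := fun x => by
    have := congrArg (fun F : E →L[ℂ] E => F x) (N.inv_mul)
    rw [hN] at this
    simp only [mul_apply_eq_comp, sub_apply,
      one_apply_eq_self] at this
    rw [← neg_sub, map_neg, this]
  have h2 : ∀ x, T τ (L x) - L x = -x := fun x => by
    have := congrArg (fun F : E →L[ℂ] E => F x) (N.mul_inv)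
    rw [hN] at this
    simp only [mul_apply_eq_comp, sub_apply,
      one_apply_eq_self] at this
    rw [← neg_sub, this]
  -- Apply `L` to `T(τ)T(t)Lx - T(t)Lx = -T(t)x` and cancel `L` against `T(τ) - 1` on the left.
  have hcomm : ∀ t x, L (T t x) = T t (L x) := fun t x => by
    have : T τ (T t (L x)) - T t (L x) = T t (T τ (L x) - L x) := by
      rw [map_sub, hT.comm]
    have h3 := h1 (T t (L x))
    rw [this, h2, map_neg, map_neg, neg_inj] at h3
    exact h3
  -- As `A ∫₀^τ T(s) ds = T(τ) - 1`, composing the integral with `(1 - T(τ))⁻¹` inverts `-A`.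
  refine ⟨L.comp (hT.orbitIntegralCLM τ), fun y => ?_, fun x => ?_⟩
  · obtain ⟨hy, hAy⟩ := hT.generator_orbitIntegral τ y
    obtain ⟨hz, hAz⟩ := generator_of_commute hcomm ⟨_, hy⟩
    refine ⟨hz, ?_⟩
    simp only [ContinuousLinearMap.comp_apply, orbitIntegralCLM_apply]
    rw [hAz, hAy, h1]
    simp
  · simp only [zero_smul, zero_sub, map_neg, ContinuousLinearMap.comp_apply,
      orbitIntegralCLM_apply, hT.orbitIntegral_generator, h1, neg_neg]

end IsC0Semigroup

end Semigroups

/-! ### The extrapolation space as an isometric copy of `X`. -/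

section Extrapolation

variable {E : Type*} [NormedAddCommGroup E] [NormedSpace ℂ E] [CompleteSpace E]
  {T : ℝ≥0 → E →L[ℂ] E} {β : ℂ}

omit [CompleteSpace E] in
theorem IsResolventAt.injective {A : E →ₗ.[ℂ] E} {R : E →L[ℂ] E} (h : IsResolventAt A β R) :
    Function.Injective R := by
  rw [injective_iff_map_eq_zero]
  intro y hy
  obtain ⟨h1, h2⟩ := h.1 y
  have : (⟨R y, h1⟩ : A.domain) = 0 := Subtype.ext hy
  rw [this, hy] at h2
  simpa using h2.symm

/-- By the choice of norm on `X₋₁` the resolvent is isometric on the dense copy of `X`. Its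
extension is isometric, so its range is closed by completeness; the range contains the dense set
`D(A)`. -/
theorem exists_extrapEquiv (hT : IsC0Semigroup T) (hβ : β ∈ genResolventSet (generator T)) :
    ∃ Λ : Extrapolation (generator T) β ≃ₗᵢ[ℂ] E,
      ∀ x, Λ (extrapIncl (generator T) β x) = genResolvent (generator T) β x := by
  set R := genResolvent (generator T) β with hR
  set ι := extrapIncl (generator T) β with hι
  have hdense : DenseRange ι := denseRange_extrapIncl _ _
  set L := R.toLinearMap.extendOfNorm ι with hL
  have hLι : ∀ x, L (ι x) = R x := fun x =>
    LinearMap.extendOfNorm_eq hdense ⟨1, fun y => by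
      rw [one_mul, norm_extrapIncl]; exact le_rfl⟩ x
  have hnorm : ∀ z, ‖L z‖ = ‖z‖ := fun z =>
    hdense.induction (P := fun z => ‖L z‖ = ‖z‖)
      (by rintro _ ⟨x, rfl⟩; rw [hLι, norm_extrapIncl])
      (isClosed_eq (by fun_prop) (by fun_prop)) z
  let Li : Extrapolation (generator T) β →ₗᵢ[ℂ] E := ⟨L.toLinearMap, hnorm⟩
  have hsurj : Function.Surjective Li := by
    have hcl : IsClosed (range Li) := Li.isometry.isClosedEmbedding.isClosed_range
    have hsub : ((generator T).domain : Set E) ⊆ range Li := fun x hx =>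
      ⟨ι (β • x - generator T ⟨x, hx⟩),
        (hLι _).trans ((isResolventAt_genResolvent hβ).2 ⟨x, hx⟩)⟩
    intro y
    exact hcl.closure_subset_iff.2 hsub (hT.dense_domain y)
  exact ⟨LinearIsometryEquiv.ofSurjective Li hsurj, hLι⟩

/-- The isometry of `X₋₁` onto `X` that extends the resolvent. -/
noncomputable def extrapEquiv (hT : IsC0Semigroup T)
    (hβ : β ∈ genResolventSet (generator T)) : Extrapolation (generator T) β ≃ₗᵢ[ℂ] E :=
  (exists_extrapEquiv hT hβ).choose

variable (hT : IsC0Semigroup T) (hβ : β ∈ genResolventSet (generator T))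

theorem extrapEquiv_incl (x : E) :
    extrapEquiv hT hβ (extrapIncl (generator T) β x) = genResolvent (generator T) β x :=
  (exists_extrapEquiv hT hβ).choose_spec x

theorem extrapEquiv_extrapSemigroup (t : ℝ≥0) (z : Extrapolation (generator T) β) :
    extrapEquiv hT hβ (extrapSemigroup T β t z) = T t (extrapEquiv hT hβ z) := by
  refine (denseRange_extrapIncl (generator T) β).induction
    (P := fun z => extrapEquiv hT hβ (extrapSemigroup T β t z) = T t (extrapEquiv hT hβ z)) ?_
    (isClosed_eq ?_ ?_) z
  · rintro _ ⟨x, rfl⟩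
    rw [extrapSemigroup_incl hT hβ, extrapEquiv_incl, extrapEquiv_incl, genResolvent_comm hT hβ]
  · exact (extrapEquiv hT hβ).continuous.comp (extrapSemigroup T β t).continuous
  · exact (T t).continuous.comp (extrapEquiv hT hβ).continuous

theorem extrapEquiv_diffQuot (z : Extrapolation (generator T) β) (t : ℝ≥0) :
    extrapEquiv hT hβ (diffQuot (extrapSemigroup T β) z t) =
      diffQuot T (extrapEquiv hT hβ z) t := by
  simp only [diffQuot, map_smul, map_sub, extrapEquiv_extrapSemigroup]

/-- This conjugates `A₋₁` to `A`, so the inverse of `A₋₁` can be read off from that of `A`. -/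
theorem tendsto_diffQuot_extrap_iff (z w : Extrapolation (generator T) β) :
    Tendsto (diffQuot (extrapSemigroup T β) z) (𝓝[>] 0) (𝓝 w) ↔
      Tendsto (diffQuot T (extrapEquiv hT hβ z)) (𝓝[>] 0) (𝓝 (extrapEquiv hT hβ w)) := by
  have h := (extrapEquiv hT hβ).isometry.isEmbedding.tendsto_nhds_iff
    (f := diffQuot (extrapSemigroup T β) z) (l := 𝓝[>] 0) (y := w)
  rw [h]
  refine tendsto_congr fun t => ?_
  simp [extrapEquiv_diffQuot]

/-- The inverse of `A₋₁`, given an inverse `-R₀` of `A`. -/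
noncomputable def extrapInverse (R₀ : E →L[ℂ] E) : Extrapolation (generator T) β →L[ℂ] E :=
  (-(ContinuousLinearMap.id ℂ E + β • R₀)).comp
    ((extrapEquiv hT hβ).toContinuousLinearEquiv : Extrapolation (generator T) β →L[ℂ] E)

theorem extrapInverse_apply (R₀ : E →L[ℂ] E) (z : Extrapolation (generator T) β) :
    extrapInverse hT hβ R₀ z = -(extrapEquiv hT hβ z + β • R₀ (extrapEquiv hT hβ z)) := rfl

variable {R₀ : E →L[ℂ] E} (hR₀ : IsResolventAt (generator T) 0 R₀)
include hR₀

omit [CompleteSpace E] in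
theorem resolvent_zero_generator (x : (generator T).domain) : R₀ (generator T x) = -x := by
  have := hR₀.2 x
  rw [zero_smul, zero_sub, map_neg] at this
  rw [← this, neg_neg]

omit [CompleteSpace E] in
theorem generator_resolvent_zero (y : E) :
    ∃ h : R₀ y ∈ (generator T).domain, generator T ⟨R₀ y, h⟩ = -y := by
  obtain ⟨h1, h2⟩ := hR₀.1 y
  refine ⟨h1, ?_⟩
  rw [zero_smul, zero_sub] at h2
  rw [neg_eq_iff_eq_neg.1 h2]

omit [CompleteSpace E] in
theorem resolvent_zero_comm (hT : IsC0Semigroup T) (t : ℝ≥0) (x : E) :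
    R₀ (T t x) = T t (R₀ x) := by
  obtain ⟨h1, h2⟩ := generator_resolvent_zero hR₀ x
  obtain ⟨h3, h4⟩ := generator_of_commute (L := T t) (fun s y => hT.comm t s y) ⟨_, h1⟩
  have := resolvent_zero_generator hR₀ ⟨_, h3⟩
  rw [h4, h2, map_neg, map_neg, neg_inj] at this
  exact this

/-- A resolvent identity: with `R₀ = -A⁻¹`, the vector `y + β R₀ y` is `(β - A) R₀ y`, and the
resolvent returns `R₀ y`. -/
theorem genResolvent_extrapInverse (z : Extrapolation (generator T) β) :
    genResolvent (generator T) β (extrapInverse hT hβ R₀ z) = -R₀ (extrapEquiv hT hβ z) := by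
  obtain ⟨h1, h2⟩ := generator_resolvent_zero hR₀ (extrapEquiv hT hβ z)
  have h3 := (isResolventAt_genResolvent hβ).2 ⟨_, h1⟩
  rw [h2, sub_neg_eq_add, add_comm] at h3
  rw [extrapInverse_apply, map_neg, neg_inj]
  exact h3

theorem extrapInverse_incl (x : E) :
    extrapInverse hT hβ R₀ (extrapIncl (generator T) β x) = -R₀ x := by
  obtain ⟨h1, h2⟩ := (isResolventAt_genResolvent hβ).1 x
  have := resolvent_zero_generator hR₀ ⟨_, h1⟩
  rw [extrapInverse_apply, extrapEquiv_incl]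
  conv_rhs => rw [← h2, map_sub, this, map_smul]
  rw [sub_neg_eq_add, add_comm]

theorem isExtrapInverse_extrapInverse : IsExtrapInverse T β (extrapInverse hT hβ R₀) := by
  refine ⟨fun z => ?_, fun z => ?_⟩
  · refine generator_of_tendsto ((tendsto_diffQuot_extrap_iff hT hβ _ _).2 ?_)
    rw [extrapEquiv_incl, genResolvent_extrapInverse hT hβ hR₀]
    obtain ⟨h1, h2⟩ := generator_resolvent_zero hR₀ (-extrapEquiv hT hβ z)
    have := generator_apply_tendsto T ⟨_, h1⟩
    rw [h2, neg_neg] at this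
    simpa only [map_neg] using this
  · apply (extrapEquiv hT hβ).injective
    rw [extrapEquiv_incl, genResolvent_extrapInverse hT hβ hR₀]
    obtain ⟨h1, h2⟩ := generator_of_tendsto ((tendsto_diffQuot_extrap_iff hT hβ _ _).1
      (generator_apply_tendsto (extrapSemigroup T β) z))
    rw [← h2, resolvent_zero_generator hR₀, neg_neg]

end Extrapolation

/-! ### Convolutions with bounded control operators. -/

section Convolution

variable {E U : Type*} [NormedAddCommGroup E] [NormedSpace ℂ E]
  [NormedAddCommGroup U] [NormedSpace ℂ U] {T : ℝ≥0 → E →L[ℂ] E}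

/-- The convolution `∫₀ᵗ T(t - s) b f(s) ds` for a bounded operator `b`. -/
noncomputable def conv (T : ℝ≥0 → E →L[ℂ] E) (b : U →L[ℂ] E) (t : ℝ≥0) (f : ℝ → U) : E :=
  ∫ s in (0 : ℝ)..t, T (Real.toNNReal ((t : ℝ) - s)) (b (f s))

/-- `f` is measurable and essentially bounded by `C` on `[0, t)`. -/
def IsBddInput (f : ℝ → U) (t : ℝ≥0) (C : ℝ) : Prop :=
  AEStronglyMeasurable f (volume.restrict (Ico (0 : ℝ) t)) ∧
    ∀ᵐ s ∂volume.restrict (Ico (0 : ℝ) t), ‖f s‖ ≤ C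

theorem restrict_Ico_eq_uIoc (t : ℝ≥0) :
    volume.restrict (Ico (0 : ℝ) t) = volume.restrict (uIoc (0 : ℝ) t) := by
  rw [uIoc_of_le (NNReal.coe_nonneg t)]
  exact Measure.restrict_congr_set Ico_ae_eq_Ioc

variable {b : U →L[ℂ] E} {t h : ℝ≥0} {f g : ℝ → U} {C : ℝ}

theorem conv_congr (hfg : f =ᵐ[volume.restrict (Ico (0 : ℝ) t)] g) :
    conv T b t f = conv T b t g := by
  rw [restrict_Ico_eq_uIoc] at hfg
  refine intervalIntegral.integral_congr_ae_restrict ?_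
  filter_upwards [hfg] with s hs
  rw [hs]

theorem conv_smul (c : ℂ) : conv T b t (c • f) = c • conv T b t f := by
  simp only [conv, Pi.smul_apply, map_smul, intervalIntegral.integral_smul]

theorem norm_conv_le {K : ℝ} (hK0 : 0 ≤ K) (hK : ∀ s ≤ t, ‖T s‖ ≤ K)
    (hf : ∀ᵐ s ∂volume.restrict (Ico (0 : ℝ) t), ‖f s‖ ≤ C) :
    ‖conv T b t f‖ ≤ K * (‖b‖ * C) * t := by
  have h := intervalIntegral.norm_integral_le_of_norm_le_const_ae (a := 0) (b := (t : ℝ))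
    (f := fun s => T (Real.toNNReal ((t : ℝ) - s)) (b (f s))) (C := K * (‖b‖ * C)) ?_
  · simpa [conv] using h
  · rw [restrict_Ico_eq_uIoc, ae_restrict_iff' measurableSet_uIoc] at hf
    filter_upwards [hf] with s hs hsm
    have hst : Real.toNNReal ((t : ℝ) - s) ≤ t := by
      rw [uIoc_of_le (NNReal.coe_nonneg t)] at hsm
      exact Real.toNNReal_le_iff_le_coe.2 (sub_le_self _ hsm.1.le)
    refine ((T _).le_opNorm _).trans ?_
    refine mul_le_mul (hK _ hst) ((b.le_opNorm _).trans ?_) (norm_nonneg _) hK0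
    exact mul_le_mul_of_nonneg_left (hs hsm) (norm_nonneg _)

variable [CompleteSpace E]

theorem IsBddInput.intervalIntegrable (hT : IsC0Semigroup T) (b : U →L[ℂ] E)
    (hf : IsBddInput f t C) :
    IntervalIntegrable (fun s => T (Real.toNNReal ((t : ℝ) - s)) (b (f s))) volume 0 t := by
  obtain ⟨K, hK0, hK⟩ := hT.exists_norm_le t
  obtain ⟨hm, hC⟩ := hf
  rw [restrict_Ico_eq_uIoc] at hm hC
  have hfin : IsFiniteMeasure (volume.restrict (uIoc (0 : ℝ) t)) :=
    ⟨by rw [Measure.restrict_apply_univ, uIoc_of_le (NNReal.coe_nonneg t)]; exact measure_Ioc_lt_top⟩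
  rw [intervalIntegrable_iff, IntegrableOn]
  refine Integrable.of_bound (C := K * (‖b‖ * C)) ?_ ?_
  · refine hT.continuous_uncurry.comp_aestronglyMeasurable (AEStronglyMeasurable.prodMk
      (f := fun s => Real.toNNReal ((t : ℝ) - s)) (g := fun s => b (f s)) ?_ ?_)
    · exact Continuous.aestronglyMeasurable (by fun_prop)
    · exact b.continuous.comp_aestronglyMeasurable hm
  · filter_upwards [hC, ae_restrict_mem measurableSet_uIoc] with s hs hsm
    have hst : Real.toNNReal ((t : ℝ) - s) ≤ t := by
      rw [uIoc_of_le (NNReal.coe_nonneg t)] at hsm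
      exact Real.toNNReal_le_iff_le_coe.2 (sub_le_self _ hsm.1.le)
    refine ((T _).le_opNorm _).trans ?_
    refine mul_le_mul (hK _ hst) ((b.le_opNorm _).trans ?_) (norm_nonneg _) hK0.le
    exact mul_le_mul_of_nonneg_left hs (norm_nonneg _)

theorem conv_add (hT : IsC0Semigroup T) {C D : ℝ} (hf : IsBddInput f t C)
    (hg : IsBddInput g t D) : conv T b t (f + g) = conv T b t f + conv T b t g := by
  simp only [conv, Pi.add_apply, map_add]
  exact intervalIntegral.integral_add (hf.intervalIntegrable hT b) (hg.intervalIntegrable hT b)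

theorem map_conv (hT : IsC0Semigroup T) {L : E →L[ℂ] E} (hL : ∀ t x, L (T t x) = T t (L x))
    (hf : IsBddInput f t C) : L (conv T b t f) = conv T (L.comp b) t f := by
  rw [conv, ← L.intervalIntegral_comp_comm (hf.intervalIntegrable hT b)]
  simp only [hL, conv, ContinuousLinearMap.comp_apply]

/-- The cocycle property of the convolution. -/
theorem conv_add_time (hT : IsC0Semigroup T) (hf : IsBddInput f (t + h) C) :
    conv T b (t + h) f = T h (conv T b t f) + conv T b h (fun s => f (t + s)) := by
  have hint := hf.intervalIntegrable hT b
  have hsub : Ico (0 : ℝ) t ⊆ Ico (0 : ℝ) (t + h : ℝ≥0) := by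
    refine Ico_subset_Ico_right ?_
    simp
  have hft : IsBddInput f t C :=
    ⟨hf.1.mono_measure (Measure.restrict_mono hsub le_rfl),
      ae_mono (Measure.restrict_mono hsub le_rfl) hf.2⟩
  have ht0 : (0 : ℝ) ≤ t := t.2
  have hh0 : (0 : ℝ) ≤ h := h.2
  have hmem : (t : ℝ) ∈ uIcc (0 : ℝ) (t + h : ℝ≥0) := by
    rw [uIcc_of_le (NNReal.coe_nonneg _)]
    exact ⟨ht0, by simp⟩
  rw [conv, ← intervalIntegral.integral_add_adjacent_intervals
    (hint.mono_set (uIcc_subset_uIcc_left hmem)) (hint.mono_set (uIcc_subset_uIcc_right hmem))]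
  congr 1
  · rw [conv, ← (T h).intervalIntegral_comp_comm (hft.intervalIntegrable hT b)]
    refine intervalIntegral.integral_congr fun s hs => ?_
    rw [uIcc_of_le ht0] at hs
    have : Real.toNNReal (((t + h : ℝ≥0) : ℝ) - s) = h + Real.toNNReal (t - s) := by
      rw [← Real.toNNReal_coe (r := h), ← Real.toNNReal_add hh0 (sub_nonneg.2 hs.2)]
      simp only [Real.toNNReal_coe, NNReal.coe_add]
      congr 1; ring
    simp only [this, hT.add_apply]
  · have := intervalIntegral.integral_comp_add_left (a := 0) (b := h)
      (fun s : ℝ => T (Real.toNNReal (((t + h : ℝ≥0) : ℝ) - s)) (b (f s))) t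
    rw [add_zero, ← NNReal.coe_add] at this
    rw [← this, conv]
    refine intervalIntegral.integral_congr fun s _ => ?_
    have : ((t + h : ℝ≥0) : ℝ) - (t + s) = h - s := by push_cast; ring
    simp only [this]

end Convolution

/-! ### Transfer of the input integral from `X₋₁` to `X`. -/

section InputConv

variable {E U : Type*} [NormedAddCommGroup E] [NormedSpace ℂ E] [CompleteSpace E]
  [NormedAddCommGroup U] [NormedSpace ℂ U] {T : ℝ≥0 → E →L[ℂ] E} {β : ℂ}
  (hT : IsC0Semigroup T) (hβ : β ∈ genResolventSet (generator T))

/-- The control operator transported to `X` by the isometry `X₋₁ ≃ X`. -/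
noncomputable def transportedControl (B : U →L[ℂ] Extrapolation (generator T) β) : U →L[ℂ] E :=
  ((extrapEquiv hT hβ).toContinuousLinearEquiv : Extrapolation (generator T) β →L[ℂ] E).comp B

/-- No integrability is required: an invertible continuous linear map commutes with the Bochner
integral in every case. -/
theorem extrapEquiv_inputConv (B : U →L[ℂ] Extrapolation (generator T) β) (t : ℝ≥0) (f : ℝ → U) :
    extrapEquiv hT hβ (inputConv T β B t f) = conv T (transportedControl hT hβ B) t f := by
  have h := (extrapEquiv hT hβ).toContinuousLinearEquiv.integral_comp_comm
    (μ := volume.restrict (Ioc (0 : ℝ) t))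
    (fun s => extrapSemigroup T β (Real.toNNReal ((t : ℝ) - s)) (B (f s)))
  rw [inputConv, conv, intervalIntegral.integral_of_le (NNReal.coe_nonneg t),
    intervalIntegral.integral_of_le (NNReal.coe_nonneg t)]
  refine h.symm.trans (integral_congr_ae (.of_forall fun s => ?_))
  exact extrapEquiv_extrapSemigroup hT hβ _ _

theorem incl_eq_inputConv_iff (B : U →L[ℂ] Extrapolation (generator T) β) (t : ℝ≥0) (f : ℝ → U)
    (y : E) : extrapIncl (generator T) β y = inputConv T β B t f ↔
      genResolvent (generator T) β y = conv T (transportedControl hT hβ B) t f := by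
  rw [← extrapEquiv_inputConv, ← extrapEquiv_incl hT hβ, (extrapEquiv hT hβ).injective.eq_iff]

/-- If `z` is the value in `X` of the input integral, then `A⁻¹ z` is the convolution with
`A₋₁⁻¹ B`. -/
theorem conv_extrapInverse {R₀ : E →L[ℂ] E} (hR₀ : IsResolventAt (generator T) 0 R₀)
    (B : U →L[ℂ] Extrapolation (generator T) β) {t : ℝ≥0} {f : ℝ → U} {C : ℝ}
    (hf : IsBddInput f t C) {z : E} (hz : extrapIncl (generator T) β z = inputConv T β B t f) :
    conv T ((extrapInverse hT hβ R₀).comp B) t f = -R₀ z := by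
  rw [← extrapInverse_incl hT hβ hR₀, hz, extrapInverse, ContinuousLinearMap.comp_assoc,
    ContinuousLinearMap.comp_apply]
  change _ = (-(ContinuousLinearMap.id ℂ E + β • R₀)) (extrapEquiv hT hβ (inputConv T β B t f))
  rw [extrapEquiv_inputConv, map_conv hT ?_ hf]
  · rfl
  · intro t x
    simp [resolvent_zero_comm hR₀ hT]

end InputConv

/-! ### Essential bounds and the `L^∞` norm. -/

section EssBounded

variable {α U : Type*} [MeasurableSpace α] {μ : Measure α} [NormedAddCommGroup U]

theorem ae_norm_le_norm_Lp_top (u : Lp U ∞ μ) : ∀ᵐ x ∂μ, ‖u x‖ ≤ ‖u‖ := by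
  filter_upwards [ae_le_eLpNormEssSup (f := u) (μ := μ)] with x hx
  rw [Lp.norm_def, eLpNorm_exponent_top]
  have hfin : eLpNormEssSup u μ ≠ ∞ := by
    rw [← eLpNorm_exponent_top]; exact Lp.eLpNorm_ne_top u
  simpa using ENNReal.toReal_mono hfin hx

theorem exists_Lp_top_of_ae_bound {f : α → U} {C : ℝ} (hC : 0 ≤ C)
    (hf : AEStronglyMeasurable f μ) (hb : ∀ᵐ x ∂μ, ‖f x‖ ≤ C) :
    ∃ u : Lp U ∞ μ, u =ᵐ[μ] f ∧ ‖u‖ ≤ C := by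
  have hle : eLpNorm f ∞ μ ≤ ENNReal.ofReal C := by
    rw [eLpNorm_exponent_top]; exact eLpNormEssSup_le_of_ae_bound hb
  have hmem : MemLp f ∞ μ := ⟨hf, hle.trans_lt ENNReal.ofReal_lt_top⟩
  refine ⟨hmem.toLp f, hmem.coeFn_toLp, ?_⟩
  rw [Lp.norm_toLp]
  exact ENNReal.toReal_le_of_le_ofReal hC hle

end EssBounded

/-! ### Restricting, shifting, delaying and extending inputs. -/

section BddInput

variable {U : Type*} [NormedAddCommGroup U] {f : ℝ → U} {t h : ℝ≥0} {C : ℝ}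

theorem isBddInput_iff : IsBddInput f t C ↔
    AEStronglyMeasurable f (volume.restrict (Ico (0 : ℝ) t)) ∧
      ∀ᵐ s : ℝ, s ∈ Ico (0 : ℝ) t → ‖f s‖ ≤ C := by
  rw [IsBddInput, ae_restrict_iff' measurableSet_Ico]

theorem isBddInput_coeFn (u : Lp U ∞ (volume.restrict (Ico (0 : ℝ) t))) :
    IsBddInput u t ‖u‖ :=
  ⟨Lp.aestronglyMeasurable u, ae_norm_le_norm_Lp_top u⟩

theorem isBddInput_coeFn_LInf (u : LInf U) (t : ℝ≥0) : IsBddInput u t ‖u‖ :=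
  ⟨(Lp.stronglyMeasurable u).aestronglyMeasurable,
    ae_mono (Measure.restrict_mono Ico_subset_Ici_self le_rfl) (ae_norm_le_norm_Lp_top u)⟩

theorem IsBddInput.mono_time (hf : IsBddInput f h C) (hth : t ≤ h) : IsBddInput f t C := by
  have hsub : Ico (0 : ℝ) t ⊆ Ico (0 : ℝ) h := Ico_subset_Ico_right (NNReal.coe_le_coe.2 hth)
  exact ⟨hf.1.mono_measure (Measure.restrict_mono hsub le_rfl),
    ae_mono (Measure.restrict_mono hsub le_rfl) hf.2⟩

theorem ae_comp_add_left {p : ℝ → Prop} (hp : ∀ᵐ s, p s) (t : ℝ) : ∀ᵐ s, p (t + s) :=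
  (measurePreserving_add_left volume t).quasiMeasurePreserving.ae hp

theorem isBddInput_comp_add_left (hm : StronglyMeasurable f) (hf : IsBddInput f (t + h) C) :
    IsBddInput (fun s => f (t + s)) h C := by
  refine isBddInput_iff.2 ⟨(hm.comp_measurable (measurable_const_add _)).aestronglyMeasurable, ?_⟩
  filter_upwards [ae_comp_add_left (isBddInput_iff.1 hf).2 t] with s hs hsm
  refine hs ⟨add_nonneg t.2 hsm.1, ?_⟩
  rw [NNReal.coe_add]
  exact add_lt_add_right hsm.2 _

theorem isBddInput_delay (hm : StronglyMeasurable f) (hf : IsBddInput f t C) (hC : 0 ≤ C)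
    (d : ℝ≥0) : IsBddInput ((Ici (d : ℝ)).indicator fun s => f (s - d)) (d + t) C := by
  refine isBddInput_iff.2 ⟨((hm.comp_measurable (measurable_sub_const _)).indicator
    measurableSet_Ici).aestronglyMeasurable, ?_⟩
  have h := ae_comp_add_left (isBddInput_iff.1 hf).2 (-d)
  filter_upwards [h] with s hs hsm
  by_cases hd : s ∈ Ici (d : ℝ)
  · rw [indicator_of_mem hd, sub_eq_neg_add]
    refine hs ⟨by simpa using hd, ?_⟩
    have := hsm.2
    push_cast at this
    linarith
  · rw [indicator_of_notMem hd, norm_zero]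
    exact hC

theorem IsBddInput.exists_LInf (hf : IsBddInput f t C) (hC : 0 ≤ C) :
    ∃ u : LInf U, u =ᵐ[volume.restrict (Ico (0 : ℝ) t)] f := by
  have hsub : Ico (0 : ℝ) t ⊆ Ici 0 := Ico_subset_Ici_self
  have hm : AEStronglyMeasurable ((Ico (0 : ℝ) t).indicator f) (volume.restrict (Ici 0)) := by
    rw [aestronglyMeasurable_indicator_iff measurableSet_Ico,
      Measure.restrict_restrict_of_subset hsub]
    exact hf.1
  obtain ⟨u, hu, -⟩ := exists_Lp_top_of_ae_bound hC hm (by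
    refine ae_restrict_of_ae ?_
    filter_upwards [(isBddInput_iff.1 hf).2] with s hs
    by_cases h : s ∈ Ico (0 : ℝ) t
    · rw [indicator_of_mem h]; exact hs h
    · rw [indicator_of_notMem h, norm_zero]; exact hC)
  refine ⟨u, ?_⟩
  filter_upwards [ae_mono (Measure.restrict_mono hsub le_rfl) hu,
    ae_restrict_mem measurableSet_Ico] with s hs hsm
  rw [hs, indicator_of_mem hsm]

end BddInput

/-! ### The input map and its norm `κ(t)`. -/

section InputMap

variable {E U : Type*} [NormedAddCommGroup E] [NormedSpace ℂ E] [CompleteSpace E]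
  [NormedAddCommGroup U] [NormedSpace ℂ U] [CompleteSpace U] {T : ℝ≥0 → E →L[ℂ] E}
  {R : E →L[ℂ] E} {b : U →L[ℂ] E}

/-- All convolutions with inputs in `L^∞` lie in the range of `R`. -/
def IsConvAdmissible (T : ℝ≥0 → E →L[ℂ] E) (R : E →L[ℂ] E) (b : U →L[ℂ] E) : Prop :=
  ∀ (t : ℝ≥0) (u : LInf U), ∃ y : E, R y = conv T b t u

omit [CompleteSpace E] [CompleteSpace U] in
theorem IsConvAdmissible.exists_preimage (hb : IsConvAdmissible T R b) {f : ℝ → U} {t : ℝ≥0}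
    {C : ℝ} (hf : IsBddInput f t C) (hC : 0 ≤ C) : ∃ y, R y = conv T b t f := by
  obtain ⟨u, hu⟩ := hf.exists_LInf hC
  obtain ⟨y, hy⟩ := hb t u
  exact ⟨y, hy.trans (conv_congr hu)⟩

/-- Closed graph theorem: `R ∘ Φ` is a convolution, hence bounded, and injectivity of `R` identifies
a limit of `Φ u` with the value at the limit. -/
theorem exists_inputMap (hT : IsC0Semigroup T) (hR : Function.Injective R)
    (hb : IsConvAdmissible T R b) (t : ℝ≥0) :
    ∃ Φ : Lp U ∞ (volume.restrict (Ico (0 : ℝ) t)) →L[ℂ] E, ∀ u, R (Φ u) = conv T b t u := by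
  choose Φ hΦ using fun u : Lp U ∞ (volume.restrict (Ico (0 : ℝ) t)) =>
    hb.exists_preimage (isBddInput_coeFn u) (norm_nonneg u)
  let Φl : Lp U ∞ (volume.restrict (Ico (0 : ℝ) t)) →ₗ[ℂ] E :=
    { toFun := Φ
      map_add' := fun u v => hR <| by
        rw [map_add, hΦ, hΦ, hΦ, conv_congr (Lp.coeFn_add u v),
          conv_add hT (isBddInput_coeFn u) (isBddInput_coeFn v)]
      map_smul' := fun c u => hR <| by
        rw [RingHom.id_apply, map_smul, hΦ, hΦ, conv_congr (Lp.coeFn_smul c u), conv_smul] }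
  obtain ⟨K, hK0, hK⟩ := hT.exists_norm_le t
  have hbound : ∀ u, ‖R (Φl u)‖ ≤ K * (‖b‖ * ‖u‖) * t := fun u => by
    change ‖R (Φ u)‖ ≤ _
    rw [hΦ]
    exact norm_conv_le hK0.le hK (isBddInput_coeFn u).2
  have hcont : Continuous (R.toLinearMap ∘ₗ Φl) :=
    AddMonoidHomClass.continuous_of_bound _ (K * ‖b‖ * t) fun u =>
      (hbound u).trans_eq (by ring)
  refine ⟨⟨Φl, Φl.continuous_of_seq_closed_graph fun u x y hux huy => hR ?_⟩, hΦ⟩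
  exact tendsto_nhds_unique ((R.continuous.tendsto y).comp huy) ((hcont.tendsto x).comp hux)

/-- The map `u ↦ ∫₀ᵗ T₋₁(t - s) B u(s) ds` from `L^∞([0, t), U)` to `X`. -/
noncomputable def inputMap (hT : IsC0Semigroup T) (hR : Function.Injective R)
    (hb : IsConvAdmissible T R b) (t : ℝ≥0) :
    Lp U ∞ (volume.restrict (Ico (0 : ℝ) t)) →L[ℂ] E :=
  (exists_inputMap hT hR hb t).choose

variable (hT : IsC0Semigroup T) (hR : Function.Injective R) (hb : IsConvAdmissible T R b)

theorem map_inputMap (t : ℝ≥0) (u : Lp U ∞ (volume.restrict (Ico (0 : ℝ) t))) :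
    R (inputMap hT hR hb t u) = conv T b t u :=
  (exists_inputMap hT hR hb t).choose_spec u

theorem norm_le_opNorm_inputMap {t : ℝ≥0} {f : ℝ → U} {C : ℝ} (hf : IsBddInput f t C)
    (hC : 0 ≤ C) {y : E} (hy : R y = conv T b t f) : ‖y‖ ≤ ‖inputMap hT hR hb t‖ * C := by
  obtain ⟨u, hu, huC⟩ := exists_Lp_top_of_ae_bound hC hf.1 hf.2
  have : y = inputMap hT hR hb t u := hR <| by rw [map_inputMap, hy, conv_congr hu]
  rw [this]
  exact ((inputMap hT hR hb t).le_opNorm u).trans (by gcongr)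

/-- Preceding an input by a zero stretch of length `d` changes neither its norm bound nor the
resulting state. -/
theorem monotone_norm_inputMap : Monotone fun t => ‖inputMap hT hR hb t‖ := by
  intro t t' htt'
  obtain ⟨d, rfl⟩ : ∃ d, t' = d + t := ⟨t' - t, (tsub_add_cancel_of_le htt').symm⟩
  refine ContinuousLinearMap.opNorm_le_bound _ (norm_nonneg _) fun u => ?_
  have hbdd := isBddInput_delay (Lp.stronglyMeasurable u) (isBddInput_coeFn u) (norm_nonneg u) d
  refine norm_le_opNorm_inputMap hT hR hb hbdd (norm_nonneg u) ?_
  rw [map_inputMap, conv_add_time hT hbdd]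
  have h0 : conv T b d ((Ici (d : ℝ)).indicator fun s => u (s - d)) = 0 := by
    rw [conv_congr (g := 0)]
    · simp [conv]
    · filter_upwards [ae_restrict_mem measurableSet_Ico] with s hs
      exact indicator_of_notMem (notMem_Ici.2 hs.2) _
  rw [h0, map_zero, zero_add]
  refine conv_congr ?_
  filter_upwards [ae_restrict_mem measurableSet_Ico] with s hs
  rw [indicator_of_mem (by simpa using hs.1), add_sub_cancel_left]

theorem norm_inputMap_add_le (hcomm : ∀ t x, R (T t x) = T t (R x)) (t h : ℝ≥0) :
    ‖inputMap hT hR hb (t + h)‖ ≤ ‖T h‖ * ‖inputMap hT hR hb t‖ + ‖inputMap hT hR hb h‖ := by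
  refine ContinuousLinearMap.opNorm_le_bound _ (by positivity) fun u => ?_
  have hu := isBddInput_coeFn u
  have hu1 : IsBddInput u t ‖u‖ := hu.mono_time le_self_add
  have hu2 := isBddInput_comp_add_left (Lp.stronglyMeasurable u) hu
  obtain ⟨y, hy⟩ := hb.exists_preimage hu1 (norm_nonneg u)
  obtain ⟨z, hz⟩ := hb.exists_preimage hu2 (norm_nonneg u)
  have : inputMap hT hR hb (t + h) u = T h y + z := hR <| by
    rw [map_inputMap, map_add, hcomm, hy, hz, conv_add_time hT hu]
  rw [this]
  calc ‖T h y + z‖ ≤ ‖T h‖ * ‖y‖ + ‖z‖ := (norm_add_le _ _).trans (by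
        gcongr; exact (T h).le_opNorm y)
    _ ≤ ‖T h‖ * (‖inputMap hT hR hb t‖ * ‖u‖) + ‖inputMap hT hR hb h‖ * ‖u‖ := by
        gcongr
        · exact norm_le_opNorm_inputMap hT hR hb hu1 (norm_nonneg u) hy
        · exact norm_le_opNorm_inputMap hT hR hb hu2 (norm_nonneg u) hz
    _ = _ := by ring

theorem exists_norm_inputMap_le (hcomm : ∀ t x, R (T t x) = T t (R x)) {τ : ℝ≥0} (hτ0 : 0 < τ)
    (hτ : ‖T τ‖ ≤ 1 / 2) : ∃ K, ∀ t, ‖inputMap hT hR hb t‖ ≤ K := by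
  set κ := fun t => ‖inputMap hT hR hb t‖
  have hmono : Monotone κ := monotone_norm_inputMap hT hR hb
  have hκ0 : ∀ t, 0 ≤ κ t := fun t => norm_nonneg _
  have key : ∀ n : ℕ, κ (n * τ) ≤ 2 * κ τ := by
    intro n
    induction n with
    | zero =>
      have := hmono (zero_le (a := τ))
      have := hκ0 τ
      simp only [Nat.cast_zero, zero_mul]
      linarith
    | succ n ih =>
      have h1 : κ (n * τ + τ) ≤ ‖T τ‖ * κ (n * τ) + κ τ := norm_inputMap_add_le hT hR hb hcomm _ _
      have h2 : ‖T τ‖ * κ (n * τ) ≤ 1 / 2 * κ (n * τ) :=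
        mul_le_mul_of_nonneg_right hτ (hκ0 _)
      have h3 : ((n + 1 : ℕ) : ℝ≥0) * τ = n * τ + τ := by push_cast; ring
      rw [h3]
      linarith
  -- `2 κ(τ)` is the fixed point of `a ↦ a / 2 + κ(τ)`; monotonicity covers times between multiples
  -- of `τ`.
  refine ⟨2 * κ τ, fun t => ?_⟩
  obtain ⟨n, hn⟩ := exists_nat_ge (t / τ)
  exact (hmono ((div_le_iff₀ hτ0).1 hn)).trans (key n)

end InputMap

/-! ### From square integrable orbits to exponential decay. -/

section Datko

variable {E : Type*} [NormedAddCommGroup E] [NormedSpace ℂ E] [CompleteSpace E]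
  {T : ℝ≥0 → E →L[ℂ] E} (hT : IsC0Semigroup T)
include hT

omit [CompleteSpace E] in
-- For `s ∈ [t - l, t]` one has `‖T(t)x‖ ≤ K ‖T(s)x‖`; square and integrate over this window.
theorem mul_sq_norm_le_of_integral_le {C K : ℝ}
    (hC : ∀ (t : ℝ≥0) (x : E), ∫ s in (0 : ℝ)..t, ‖T s.toNNReal x‖ ^ 2 ≤ C * ‖x‖ ^ 2)
    {l t : ℝ≥0} (hlt : l ≤ t) (hK : ∀ s ≤ l, ‖T s‖ ≤ K) (x : E) :
    l * ‖T t x‖ ^ 2 ≤ K ^ 2 * C * ‖x‖ ^ 2 := by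
  have hlt' : (l : ℝ) ≤ t := NNReal.coe_le_coe.2 hlt
  have hcont : Continuous fun s : ℝ => ‖T s.toNNReal x‖ ^ 2 := (hT.continuous_orbit x).norm.pow 2
  have h1 : ∫ _ in ((t : ℝ) - l)..t, ‖T t x‖ ^ 2 ≤
      ∫ s in ((t : ℝ) - l)..t, K ^ 2 * ‖T s.toNNReal x‖ ^ 2 := by
    refine intervalIntegral.integral_mono_on (by simp) (by simp)
      ((continuous_const.mul hcont).intervalIntegrable _ _) fun s hs => ?_
    have hs0 : 0 ≤ s := (sub_nonneg.2 hlt').trans hs.1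
    have hts : t = ((t : ℝ) - s).toNNReal + s.toNNReal := by
      rw [← Real.toNNReal_add (sub_nonneg.2 hs.2) hs0, sub_add_cancel, Real.toNNReal_coe]
    have hl : ((t : ℝ) - s).toNNReal ≤ l := by
      rw [Real.toNNReal_le_iff_le_coe]; linarith [hs.1]
    rw [← mul_pow]
    gcongr
    conv_lhs => rw [hts, hT.add_apply]
    exact ((T _).le_opNorm _).trans (by gcongr; exact hK _ hl)
  have h2 : ∫ s in ((t : ℝ) - l)..t, ‖T s.toNNReal x‖ ^ 2 ≤
      ∫ s in (0 : ℝ)..t, ‖T s.toNNReal x‖ ^ 2 :=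
    intervalIntegral.integral_mono_interval (sub_nonneg.2 hlt') (by simp) le_rfl
      (.of_forall fun s => by positivity) (hcont.intervalIntegrable _ _)
  rw [intervalIntegral.integral_const_mul, intervalIntegral.integral_const, sub_sub_cancel,
    smul_eq_mul] at h1
  calc _ ≤ _ := h1
    _ ≤ K ^ 2 * (C * ‖x‖ ^ 2) := by gcongr; exact h2.trans (hC t x)
    _ = _ := by ring

/-- Square integrable orbits force some `T(τ)` to be a strict contraction. -/
theorem exists_norm_le_half_of_integral_le {C : ℝ} (hC0 : 0 ≤ C)
    (hC : ∀ (t : ℝ≥0) (x : E), ∫ s in (0 : ℝ)..t, ‖T s.toNNReal x‖ ^ 2 ≤ C * ‖x‖ ^ 2) :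
    ∃ τ : ℝ≥0, 0 < τ ∧ ‖T τ‖ ≤ 1 / 2 := by
  obtain ⟨K, hK0, hK⟩ := hT.exists_norm_le 1
  -- For `t ≥ 1` the window `l = 1` gives `‖T(t)‖² ≤ K² C ≤ K² (1 + C)²`; for `t ≤ 1` the bound `K ≤
  -- N` is enough.
  set N := K * (1 + C) with hN
  have hKN : K ≤ N := by nlinarith
  have hbdd : ∀ t, ‖T t‖ ≤ N := by
    intro t
    rcases le_total t 1 with ht | ht
    · exact (hK t ht).trans hKN
    · refine (T t).opNorm_le_bound (by positivity) fun x => ?_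
      have h := mul_sq_norm_le_of_integral_le hT hC ht hK x
      rw [NNReal.coe_one, one_mul] at h
      refine le_of_sq_le_sq (h.trans ?_) (by positivity)
      rw [hN, mul_pow, mul_pow]
      gcongr
      nlinarith
  -- The full window `l = τ` gives `τ ‖T(τ)x‖² ≤ N² C ‖x‖²`, so `τ ≥ 4 N² C` yields the factor
  -- `1/4`; the `+ 1` keeps `τ` positive when `C = 0`.
  obtain ⟨τ, hτ⟩ : ∃ τ : ℝ≥0, (τ : ℝ) = 4 * (N ^ 2 * C) + 1 :=
    ⟨NNReal.mk (4 * (N ^ 2 * C) + 1) (by positivity), rfl⟩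
  refine ⟨τ, by rw [← NNReal.coe_pos, hτ]; positivity, ?_⟩
  refine ContinuousLinearMap.opNorm_le_bound _ (by norm_num) fun x => ?_
  have h := mul_sq_norm_le_of_integral_le hT hC (le_refl τ) (fun s _ => hbdd s) x
  refine le_of_sq_le_sq ?_ (by positivity)
  set y := ‖T τ x‖ ^ 2
  have hy : 0 ≤ y := by positivity
  rw [hτ] at h
  have hNC : 0 ≤ N ^ 2 * C := by positivity
  have hp : 0 < 4 * (N ^ 2 * C) + 1 := by positivity
  have : (4 * (N ^ 2 * C) + 1) * y ≤ (4 * (N ^ 2 * C) + 1) * ((1 / 2 * ‖x‖) ^ 2) := by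
    nlinarith [sq_nonneg ‖x‖]
  exact le_of_mul_le_mul_left this hp

theorem exists_exponential_bound {τ : ℝ≥0} (hτ0 : 0 < τ) (hτ : ‖T τ‖ ≤ 1 / 2) :
    ∃ M ω : ℝ, 0 < M ∧ 0 < ω ∧ ∀ t : ℝ≥0, ‖T t‖ ≤ M * Real.exp (-ω * t) := by
  obtain ⟨K, hK0, hK⟩ := hT.exists_norm_le τ
  have hτ0' : (0 : ℝ) < τ := hτ0
  have key : ∀ (n : ℕ) (r : ℝ≥0), r ≤ τ → ‖T (n * τ + r)‖ ≤ (1 / 2) ^ n * K := by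
    intro n
    induction n with
    | zero => intro r hr; simpa using hK r hr
    | succ n ih =>
      intro r hr
      have : ((n + 1 : ℕ) : ℝ≥0) * τ + r = τ + (n * τ + r) := by push_cast; ring
      rw [this, hT.map_add, pow_succ', mul_assoc]
      exact (ContinuousLinearMap.opNorm_comp_le _ _).trans
        (mul_le_mul hτ (ih r hr) (norm_nonneg _) (by norm_num))
  -- The factor `2` pays for the floor: `n ≥ t / τ - 1` gives `2⁻ⁿ ≤ 2 · 2^(-t/τ)`.
  refine ⟨2 * K, Real.log 2 / τ, by positivity, div_pos (Real.log_pos one_lt_two) hτ0', fun t => ?_⟩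
  set n := ⌊t / τ⌋₊
  have h1 : n * τ ≤ t := (le_div_iff₀ hτ0).1 (Nat.floor_le zero_le)
  have h2 : t / τ < n + 1 := Nat.lt_floor_add_one _
  obtain ⟨r, hr⟩ := exists_add_of_le h1
  have hrτ : r ≤ τ := by
    rw [div_lt_iff₀ hτ0, hr, add_mul, one_mul] at h2
    exact (lt_of_add_lt_add_left h2).le
  have h3 : (t : ℝ) / τ ≤ n + 1 := by exact_mod_cast h2.le
  have h4 : (1 / 2 : ℝ) ^ n ≤ 2 * Real.exp (-(Real.log 2 / τ) * t) := by
    have e1 : (1 / 2 : ℝ) ^ n = Real.exp (-(n * Real.log 2)) := by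
      rw [Real.exp_neg, Real.exp_nat_mul, Real.exp_log two_pos, one_div, inv_pow]
    have e2 : 2 * Real.exp (-(Real.log 2 / τ) * t) =
        Real.exp (Real.log 2 + -(Real.log 2 / τ) * t) := by
      rw [Real.exp_add, Real.exp_log two_pos]
    rw [e1, e2, Real.exp_le_exp]
    have e3 : -(Real.log 2 / τ) * t = -(Real.log 2 * (t / τ)) := by ring
    rw [e3]
    nlinarith [Real.log_pos one_lt_two]
  calc ‖T t‖ = ‖T (n * τ + r)‖ := by rw [← hr]
    _ ≤ (1 / 2) ^ n * K := key n r hrτ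
    _ ≤ 2 * Real.exp (-(Real.log 2 / τ) * t) * K := by gcongr
    _ = _ := by ring

end Datko

/-! ### The quadratic form `V` along free and perturbed orbits. -/

section Lyapunov

variable {X : Type*} [NormedAddCommGroup X] [InnerProductSpace ℂ X] [CompleteSpace X]

/-- If `im P ⊆ D(A*)`, then `A* P` is bounded. -/
theorem exists_adjoint_comp {A : X →ₗ.[ℂ] X} (hA : Dense (A.domain : Set X)) {P : X →L[ℂ] X}
    (hdom : ∀ x : X, P x ∈ A†.domain) : ∃ S : X →L[ℂ] X, ∀ x, S x = A† ⟨P x, hdom x⟩ := by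
  let Sl : X →ₗ[ℂ] X := A†.toFun ∘ₗ P.toLinearMap.codRestrict A†.domain hdom
  have hSl : ∀ (x : X) (v : A.domain), inner ℂ (Sl x) (v : X) = inner ℂ (P x) (A v) :=
    fun x v => LinearPMap.adjoint_isFormalAdjoint hA ⟨P x, hdom x⟩ v
  -- Closed graph theorem: limits are identified by testing against the dense set `D(A)`, where
  -- `⟨A*P u, v⟩ = ⟨P u, A v⟩` is continuous in `u`.
  refine ⟨⟨Sl, Sl.continuous_of_seq_closed_graph fun u x y hux huy => ?_⟩, fun x => rfl⟩
  refine hA.eq_of_inner_left ℂ fun v hv => ?_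
  have h1 : Tendsto (fun n => inner ℂ (Sl (u n)) v) atTop (𝓝 (inner ℂ y v)) :=
    huy.inner tendsto_const_nhds
  have h2 : Tendsto (fun n => inner ℂ (Sl (u n)) v) atTop (𝓝 (inner ℂ (Sl x) v)) := by
    simp only [fun x => hSl x ⟨v, hv⟩]
    exact ((P.continuous.tendsto x).comp hux).inner tendsto_const_nhds
  exact tendsto_nhds_unique h1 h2

variable {T : ℝ≥0 → X →L[ℂ] X} (hT : IsC0Semigroup T) {P PA S : X →L[ℂ] X}
  (hPA : ∀ x : (generator T).domain, PA x = P (generator T x))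
  (hS : ∀ (x : X) (v : (generator T).domain), inner ℂ (S x) (v : X) = inner ℂ (P x) (generator T v))

include hT in
theorem re_inner_le_of_domain
    (hLyap : ∀ x : (generator T).domain, (inner ℂ (PA x + S x) (x : X)).re ≤ -‖(x : X)‖ ^ 2)
    (x : X) : (inner ℂ (PA x + S x) x).re ≤ -‖x‖ ^ 2 := by
  have hcl : IsClosed {x : X | (inner ℂ (PA x + S x) x).re ≤ -‖x‖ ^ 2} :=
    isClosed_le (Complex.continuous_re.comp (by fun_prop)) (by fun_prop)
  exact hcl.closure_subset_iff.2 (fun v hv => hLyap ⟨v, hv⟩) (hT.dense_domain x)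

include hT hPA hS in
/-- The quadratic form along an orbit is the integral of its derivative. -/
theorem re_inner_orbit_sub (t : ℝ≥0) (x : X) :
    (inner ℂ (P (T t x)) (T t x)).re - (inner ℂ (P x) x).re =
      ∫ s in (0 : ℝ)..t, (inner ℂ (PA (T s.toNNReal x) + S (T s.toNNReal x))
        (T s.toNNReal x)).re := by
  have hqc : Continuous fun x : X => (inner ℂ (PA x + S x) x).re :=
    Complex.continuous_re.comp (by fun_prop)
  have hcl : IsClosed {x : X | (inner ℂ (P (T t x)) (T t x)).re - (inner ℂ (P x) x).re =
      ∫ s in (0 : ℝ)..t, (inner ℂ (PA (T s.toNNReal x) + S (T s.toNNReal x))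
        (T s.toNNReal x)).re} := by
    refine isClosed_eq ((Complex.continuous_re.comp (by fun_prop)).sub
      (Complex.continuous_re.comp (by fun_prop))) ?_
    exact intervalIntegral.continuous_parametric_intervalIntegral_of_continuous'
      (f := fun x s => (inner ℂ (PA (T s.toNNReal x) + S (T s.toNNReal x)) (T s.toNNReal x)).re)
      (hqc.comp hT.continuous_orbit_uncurry) 0 t
  -- Both sides are continuous in `x`, so it suffices to treat `D(A)`, where the orbit is
  -- differentiable from the right.
  refine hcl.closure_subset_iff.2 (fun v hv => ?_) (hT.dense_domain x)
  have hcont := hT.continuous_orbit v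
  have hderiv : ∀ s ∈ Ioo (0 : ℝ) t, HasDerivWithinAt
      (fun s : ℝ => (inner ℂ (P (T s.toNNReal v)) (T s.toNNReal v)).re)
      (inner ℂ (PA (T s.toNNReal v) + S (T s.toNNReal v)) (T s.toNNReal v)).re (Ioi s) s := by
    intro s hs
    have h1 := hT.hasDerivWithinAt_orbit (generator_apply_tendsto T ⟨v, hv⟩) hs.1.le
    have h2 := (P.restrictScalars ℝ).hasFDerivAt.comp_hasDerivWithinAt s h1
    have h3 := Complex.reCLM.hasFDerivAt.comp_hasDerivWithinAt s (h2.inner ℂ h1)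
    obtain ⟨h4, h5⟩ := generator_of_commute (L := T s.toNNReal)
      (fun r y => hT.comm _ r y) ⟨v, hv⟩
    have e : inner ℂ (PA (T s.toNNReal v) + S (T s.toNNReal v)) (T s.toNNReal v) =
        inner ℂ (P (T s.toNNReal v)) (T s.toNNReal (generator T ⟨v, hv⟩)) +
          inner ℂ (P (T s.toNNReal (generator T ⟨v, hv⟩))) (T s.toNNReal v) := by
      rw [inner_add_left, hPA ⟨_, h4⟩, hS _ ⟨_, h4⟩, h5, add_comm]
    rw [e]
    exact h3
  have := intervalIntegral.integral_eq_sub_of_hasDeriv_right_of_le (NNReal.coe_nonneg t)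
    (Complex.continuous_re.comp ((P.continuous.comp hcont).inner hcont)).continuousOn hderiv
    ((hqc.comp hcont).intervalIntegrable 0 t)
  simpa [hT.zero_apply] using this.symm

omit [CompleteSpace X] in
theorem re_inner_self_le (P : X →L[ℂ] X) (x : X) : (inner ℂ (P x) x).re ≤ ‖P‖ * ‖x‖ ^ 2 := by
  calc (inner ℂ (P x) x).re ≤ ‖P x‖ * ‖x‖ := re_inner_le_norm (𝕜 := ℂ) (P x) x
    _ ≤ ‖P‖ * ‖x‖ * ‖x‖ := by gcongr; exact P.le_opNorm x
    _ = _ := by ring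

include hT hPA hS in
theorem integral_sq_norm_orbit_le (hpos : ∀ x : X, 0 ≤ (inner ℂ (P x) x).re)
    (hq : ∀ x : X, (inner ℂ (PA x + S x) x).re ≤ -‖x‖ ^ 2) (t : ℝ≥0) (x : X) :
    ∫ s in (0 : ℝ)..t, ‖T s.toNNReal x‖ ^ 2 ≤ ‖P‖ * ‖x‖ ^ 2 := by
  have hcont := hT.continuous_orbit x
  have hqc : Continuous fun x : X => (inner ℂ (PA x + S x) x).re :=
    Complex.continuous_re.comp (by fun_prop)
  have h1 : ∫ s in (0 : ℝ)..t, (inner ℂ (PA (T s.toNNReal x) + S (T s.toNNReal x))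
      (T s.toNNReal x)).re ≤ ∫ s in (0 : ℝ)..t, -‖T s.toNNReal x‖ ^ 2 :=
    intervalIntegral.integral_mono_on (NNReal.coe_nonneg t)
      ((hqc.comp hcont).intervalIntegrable 0 t) ((hcont.norm.pow 2).neg.intervalIntegrable 0 t)
      fun s _ => hq (T s.toNNReal x)
  rw [intervalIntegral.integral_neg] at h1
  have h2 := re_inner_orbit_sub hT hPA hS t x
  have h3 := hpos (T t x)
  have h4 := re_inner_self_le P x
  linarith

theorem diniDeriv_le_of_tendsto {X U : Type*} [NormedAddCommGroup X] [NormedAddCommGroup U] {φ : ℝ≥0 → X → LInf U → X}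
    {V : X → ℝ} {u : LInf U} {x : X} {g : ℝ≥0 → ℝ} {l m : ℝ}
    (hg : ∀ t, 0 < t → (V (φ t x u) - V x) / (t : ℝ) ≤ g t) (hl : Tendsto g (𝓝[>] 0) (𝓝 l))
    (hlm : l ≤ m) : diniDeriv φ V u x ≤ (m : EReal) := by
  have h1 : Tendsto (fun t => (g t : EReal)) (𝓝[>] 0) (𝓝 (l : EReal)) :=
    (continuous_coe_real_ereal.tendsto l).comp hl
  calc diniDeriv φ V u x ≤ limsup (fun t => (g t : EReal)) (𝓝[>] 0) := by
        refine limsup_le_limsup ?_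
        filter_upwards [self_mem_nhdsWithin] with t ht
        exact EReal.coe_le_coe_iff.2 (hg t ht)
    _ = l := h1.limsup_eq
    _ ≤ m := EReal.coe_le_coe_iff.2 hlm

omit [CompleteSpace X] in
include hPA hS in
/-- The effect on the quadratic form of a perturbation in the range of the generator. -/
theorem re_inner_add_le (y : X) (w : (generator T).domain) :
    (inner ℂ (P (y + generator T w)) (y + generator T w)).re ≤ (inner ℂ (P y) y).re +
      ((‖S‖ + ‖PA‖) * ‖y‖ + ‖S‖ * ‖generator T w‖) * ‖(w : X)‖ := by
  have h1 : (inner ℂ (P (generator T w)) y).re ≤ ‖PA‖ * ‖(w : X)‖ * ‖y‖ := by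
    rw [← hPA]
    exact (re_inner_le_norm (𝕜 := ℂ) _ _).trans (by gcongr; exact PA.le_opNorm _)
  -- Used for `z = y` and for `z = A w`: the second bounds the quadratic term while still producing
  -- a factor `‖w‖`.
  have h2 : ∀ z, (inner ℂ (P z) (generator T w)).re ≤ ‖S‖ * ‖z‖ * ‖(w : X)‖ := fun z => by
    rw [← hS]
    exact (re_inner_le_norm (𝕜 := ℂ) _ _).trans (by gcongr; exact S.le_opNorm _)
  have h3 := h2 y
  have h4 := h2 (generator T w)
  simp only [map_add, inner_add_left, inner_add_right, Complex.add_re]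
  linarith

include hT hPA hS in
/-- The dissipation inequality for a perturbed orbit. -/
theorem diniDeriv_re_inner_le (hq : ∀ x : X, (inner ℂ (PA x + S x) x).re ≤ -‖x‖ ^ 2)
    {U : Type*} [NormedAddCommGroup U] {φ : ℝ≥0 → X → LInf U → X} {x : X} {u : LInf U}
    {κ : ℝ≥0 → ℝ} {κ₀ a : ℝ} (hκ : Tendsto κ (𝓝[>] 0) (𝓝 κ₀))
    (hφ : ∀ t, ∃ w : (generator T).domain, φ t x u = T t x + generator T w ∧
      ‖(w : X)‖ ≤ a * ‖u‖ * t ∧ ‖generator T w‖ ≤ κ t * ‖u‖)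
    {ε : ℝ} (hε : 0 < ε) :
    diniDeriv φ (fun x => (inner ℂ (P x) x).re) u x ≤
      (((ε - 1) * ‖x‖ ^ 2 + (1 / (4 * ε) * (‖S‖ + ‖PA‖) ^ 2 * a ^ 2 + a * ‖S‖ * κ₀) * ‖u‖ ^ 2 :
        ℝ) : EReal) := by
  have hqc : Continuous fun x : X => (inner ℂ (PA x + S x) x).re :=
    Complex.continuous_re.comp (by fun_prop)
  set q := fun x : X => (inner ℂ (PA x + S x) x).re
  refine diniDeriv_le_of_tendsto
    (g := fun t => (t : ℝ)⁻¹ • (∫ s in (0 : ℝ)..t, q (T s.toNNReal x)) +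
      ((‖S‖ + ‖PA‖) * ‖T t x‖ + ‖S‖ * (κ t * ‖u‖)) * (a * ‖u‖))
    (l := q x + ((‖S‖ + ‖PA‖) * ‖x‖ + ‖S‖ * (κ₀ * ‖u‖)) * (a * ‖u‖)) (fun t ht => ?_) ?_ ?_
  · obtain ⟨w, hw, hw1, hw2⟩ := hφ t
    have ht' : (0 : ℝ) < t := ht
    have h1 := re_inner_add_le hPA hS (T t x) w
    have h2 := re_inner_orbit_sub hT hPA hS t x
    have h3 : ((‖S‖ + ‖PA‖) * ‖T t x‖ + ‖S‖ * ‖generator T w‖) * ‖(w : X)‖ ≤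
        ((‖S‖ + ‖PA‖) * ‖T t x‖ + ‖S‖ * (κ t * ‖u‖)) * (a * ‖u‖ * t) := by
      have : 0 ≤ κ t * ‖u‖ := (norm_nonneg _).trans hw2
      gcongr
    rw [div_le_iff₀ ht', add_mul, smul_eq_mul, mul_right_comm, inv_mul_cancel₀ ht'.ne', one_mul, hw]
    simp only [q]
    linarith
  · have h1 : Tendsto (fun t : ℝ≥0 => (t : ℝ)⁻¹ • ∫ s in (0 : ℝ)..t, q (T s.toNNReal x))
        (𝓝[>] 0) (𝓝 (q x)) := by
      simpa [hT.zero_apply] using tendsto_average (hqc.comp (hT.continuous_orbit x))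
    have h2 : Tendsto (fun t : ℝ≥0 => ‖T t x‖) (𝓝[>] 0) (𝓝 ‖x‖) := by
      have := ((hT.strong_cont x).norm.tendsto 0).mono_left (nhdsWithin_le_nhds (s := Ioi 0))
      simpa [hT.zero_apply] using this
    exact h1.add (((h2.const_mul _).add ((hκ.mul_const _).const_mul _)).mul_const _)
  · have h1 := hq x
    have h2 : (‖S‖ + ‖PA‖) * ‖x‖ * (a * ‖u‖) ≤
        ε * ‖x‖ ^ 2 + 1 / (4 * ε) * ((‖S‖ + ‖PA‖) * (a * ‖u‖)) ^ 2 := by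
      set D := (‖S‖ + ‖PA‖) * (a * ‖u‖) with hD
      -- Young's inequality with weight `ε`, by completing the square.
      have e : ε * ‖x‖ ^ 2 + 1 / (4 * ε) * D ^ 2 - ‖x‖ * D =
          1 / (4 * ε) * (2 * ε * ‖x‖ - D) ^ 2 := by
        field_simp; ring
      have : 0 ≤ 1 / (4 * ε) * (2 * ε * ‖x‖ - D) ^ 2 := by positivity
      have e2 : (‖S‖ + ‖PA‖) * ‖x‖ * (a * ‖u‖) = ‖x‖ * D := by rw [hD]; ring
      linarith
    simp only [q]
    linarith

end Lyapunov

/-! ### Concrete comparison functions. -/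

section Comparison

theorem isClassKInf_const_mul_sq {c : ℝ≥0} (hc : 0 < c) : IsClassKInf fun r => c * r ^ 2 := by
  refine ⟨⟨by fun_prop, fun r s hrs => ?_, by simp⟩, ?_⟩
  · exact mul_lt_mul_of_pos_left (pow_lt_pow_left₀ hrs zero_le two_ne_zero) hc
  · rw [not_bddAbove_iff]
    intro b
    obtain ⟨r, hr⟩ := (((tendsto_pow_atTop (α := ℝ≥0) two_ne_zero).const_mul_atTop
      hc).eventually_gt_atTop b).exists
    exact ⟨_, ⟨r, rfl⟩, hr⟩

theorem isClassK_const_mul {c : ℝ≥0} (hc : 0 < c) : IsClassK fun r => c * r :=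
  ⟨by fun_prop, fun _ _ hrs => mul_lt_mul_of_pos_left hrs hc, by simp⟩

theorem isClassKL_exponential {M ω : ℝ} (hM : 0 < M) (hω : 0 < ω) :
    IsClassKL fun r t => Real.toNNReal (M * Real.exp (-ω * t)) * r := by
  have hpos : ∀ t : ℝ≥0, 0 < M * Real.exp (-ω * t) := fun t => by positivity
  refine ⟨fun t => isClassK_const_mul (Real.toNNReal_pos.2 (hpos t)), fun r hr => ⟨?_, ?_, ?_⟩⟩
  · fun_prop
  · intro s t hst
    refine mul_lt_mul_of_pos_right ?_ hr
    rw [Real.toNNReal_lt_toNNReal_iff (hpos s)]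
    have : (s : ℝ) < t := hst
    gcongr 1
    rw [Real.exp_lt_exp]
    nlinarith
  · have h1 : Tendsto (fun t : ℝ≥0 => M * Real.exp (-ω * t)) atTop (𝓝 (M * 0)) := by
      refine Tendsto.const_mul M (Real.tendsto_exp_atBot.comp ?_)
      exact (NNReal.tendsto_coe_atTop.2 tendsto_id).const_mul_atTop_of_neg (neg_neg_of_pos hω)
    have h2 := ((continuous_real_toNNReal.tendsto _).comp h1).mul_const r
    simpa using h2

end Comparison

/-! ### Mild solutions: `κ`, ISS and the control system axioms. -/

section System

variable {E U : Type*} [NormedAddCommGroup E] [NormedSpace ℂ E] [CompleteSpace E]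
  [NormedAddCommGroup U] [NormedSpace ℂ U] {T : ℝ≥0 → E →L[ℂ] E} {β : ℂ}
  (hT : IsC0Semigroup T) (hβ : β ∈ genResolventSet (generator T))
  {B : U →L[ℂ] Extrapolation (generator T) β} (hB : IsInfAdmissible T β B)

include hB in
theorem IsInfAdmissible.isConvAdmissible :
    IsConvAdmissible T (genResolvent (generator T) β) (transportedControl hT hβ B) := fun t u => by
  obtain ⟨y, hy⟩ := hB t u
  exact ⟨y, (incl_eq_inputConv_iff hT hβ B t u y).1 hy⟩

omit [CompleteSpace E] in
include hβ in
theorem genResolvent_injective : Function.Injective (genResolvent (generator T) β) :=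
  (isResolventAt_genResolvent hβ).injective

omit [CompleteSpace E] in
theorem exists_mildSolution_eq (t : ℝ≥0) (x : E) (u : LInf U) :
    ∃ z, mildSolution T β B hB t x u = T t x + z ∧
      extrapIncl (generator T) β z = inputConv T β B t u :=
  ⟨_, rfl, (hB t u).choose_spec⟩

variable [CompleteSpace U]

/-- The smallest constant `κ(t)` bounding the input map at time `t`. -/
noncomputable def inputConst (t : ℝ≥0) : ℝ :=
  ‖inputMap hT (genResolvent_injective hβ) (hB.isConvAdmissible hT hβ) t‖

theorem isLeast_inputConst (t : ℝ≥0) :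
    IsLeast {k | IsInputBound T β B t k} (inputConst hT hβ hB t) := by
  have hinj := genResolvent_injective hβ
  set Φ := inputMap hT hinj (hB.isConvAdmissible hT hβ) t with hΦ
  have : {k | IsInputBound T β B t k} = {k | 0 ≤ k ∧ ∀ u, ‖Φ u‖ ≤ k * ‖u‖} := by
    ext k
    refine and_congr_right fun _ => forall_congr' fun u => ?_
    have hu : genResolvent (generator T) β (Φ u) = conv T (transportedControl hT hβ B) t u :=
      map_inputMap hT hinj _ t u
    refine ⟨?_, fun h => ⟨Φ u, (incl_eq_inputConv_iff hT hβ B t u _).2 hu, h⟩⟩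
    rintro ⟨y, hy, hyk⟩
    rw [incl_eq_inputConv_iff hT hβ, ← hu] at hy
    rwa [← hinj hy]
  rw [this]
  exact Φ.isLeast_opNorm

theorem exists_tendsto_inputConst :
    ∃ κ₀, Tendsto (inputConst hT hβ hB) (𝓝[>] 0) (𝓝 κ₀) :=
  ⟨_, (monotone_norm_inputMap hT (genResolvent_injective hβ)
    (hB.isConvAdmissible hT hβ)).tendsto_nhdsGT 0⟩

theorem norm_le_inputConst_mul {t : ℝ≥0} {u : LInf U} {z : E}
    (hz : extrapIncl (generator T) β z = inputConv T β B t u) :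
    ‖z‖ ≤ inputConst hT hβ hB t * ‖u‖ :=
  norm_le_opNorm_inputMap hT _ _ (isBddInput_coeFn_LInf u t) (norm_nonneg u)
    ((incl_eq_inputConv_iff hT hβ B t u z).1 hz)

include hT hβ in
-- The free part decays exponentially, and the forced part is at most `κ(t) ‖u‖` with `κ` bounded
-- uniformly in time.
theorem isISS_mildSolution {τ : ℝ≥0} (hτ0 : 0 < τ) (hτ : ‖T τ‖ ≤ 1 / 2) :
    IsISS (mildSolution T β B hB) := by
  obtain ⟨M, ω, hM, hω, hexp⟩ := exists_exponential_bound hT hτ0 hτ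
  obtain ⟨K, hK⟩ := exists_norm_inputMap_le hT (genResolvent_injective hβ)
    (hB.isConvAdmissible hT hβ) (genResolvent_comm hT hβ) hτ0 hτ
  refine ⟨_, fun r => (K.toNNReal + 1) * r, isClassKL_exponential hM hω,
    isClassK_const_mul (by positivity), fun t x u => ?_⟩
  obtain ⟨z, hz, hz'⟩ := exists_mildSolution_eq hB t x u
  have h1 := norm_le_inputConst_mul hT hβ hB hz'
  have h2 : inputConst hT hβ hB t ≤ K.toNNReal + 1 :=
    (hK t).trans ((Real.le_coe_toNNReal K).trans (by simp))
  rw [← NNReal.coe_le_coe]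
  push_cast
  rw [Real.coe_toNNReal _ (by positivity), hz]
  calc ‖T t x + z‖ ≤ ‖T t‖ * ‖x‖ + ‖z‖ := (norm_add_le _ _).trans (by
        gcongr; exact (T t).le_opNorm x)
    _ ≤ M * Real.exp (-ω * t) * ‖x‖ + (K.toNNReal + 1) * ‖u‖ := by
        gcongr
        · exact hexp t
        · exact h1.trans (by gcongr)

omit [CompleteSpace U] in
include hT hβ in
-- Apart from continuity, each axiom is checked after applying the injective resolvent, where it
-- becomes a property of convolutions.
theorem isForwardComplete_mildSolution
    (hcont : ∀ (x : E) (u : LInf U), Continuous fun t => mildSolution T β B hB t x u) :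
    IsForwardComplete (mildSolution T β B hB) := by
  have hinj := genResolvent_injective hβ
  refine ⟨fun x u => ?_, fun t x u v huv => ?_, hcont, fun t h x u v hv => ?_⟩
  · obtain ⟨z, hz, hz'⟩ := exists_mildSolution_eq hB 0 x u
    have : z = 0 := hinj <| by
      rw [(incl_eq_inputConv_iff hT hβ B 0 u z).1 hz']
      simp [conv]
    rw [hz, this, hT.zero_apply, add_zero]
  · obtain ⟨z, hz, hz'⟩ := exists_mildSolution_eq hB t x u
    obtain ⟨w, hw, hw'⟩ := exists_mildSolution_eq hB t x v
    have : z = w := hinj <| by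
      rw [(incl_eq_inputConv_iff hT hβ B t u z).1 hz', (incl_eq_inputConv_iff hT hβ B t v w).1 hw']
      exact conv_congr (ae_mono (Measure.restrict_mono Ico_subset_Icc_self le_rfl) huv)
    rw [hz, hw, this]
  · obtain ⟨z, hz, hz'⟩ := exists_mildSolution_eq hB t x u
    obtain ⟨w, hw, hw'⟩ := exists_mildSolution_eq hB h (mildSolution T β B hB t x u) v
    obtain ⟨y, hy, hy'⟩ := exists_mildSolution_eq hB (t + h) x u
    have : y = T h z + w := hinj <| by
      rw [(incl_eq_inputConv_iff hT hβ B _ u y).1 hy', map_add, genResolvent_comm hT hβ,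
        (incl_eq_inputConv_iff hT hβ B t u z).1 hz', (incl_eq_inputConv_iff hT hβ B h v w).1 hw',
        conv_add_time hT (isBddInput_coeFn_LInf u _)]
      congr 1
      exact conv_congr (EventuallyEq.symm
        (ae_mono (Measure.restrict_mono Ico_subset_Ici_self le_rfl) hv))
    rw [hy, hw, hz, this, map_add, add_comm t h, hT.add_apply, add_assoc]

end System

/-! ### The dissipation inequality for mild solutions. -/

section Hilbert

variable {X U : Type*} [NormedAddCommGroup X] [InnerProductSpace ℂ X] [CompleteSpace X]
  [NormedAddCommGroup U] [NormedSpace ℂ U] [CompleteSpace U]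
  {T : ℝ≥0 → X →L[ℂ] X} {β : ℂ} (hT : IsC0Semigroup T)
  (hβ : β ∈ genResolventSet (generator T))
  {B : U →L[ℂ] Extrapolation (generator T) β} (hB : IsInfAdmissible T β B)
  {P PA S R₀ : X →L[ℂ] X} (hR₀ : IsResolventAt (generator T) 0 R₀)
  (hPA : ∀ x : (generator T).domain, PA x = P (generator T x))
  (hS : ∀ (x : X) (v : (generator T).domain), inner ℂ (S x) (v : X) = inner ℂ (P x) (generator T v))
  (hq : ∀ x : X, (inner ℂ (PA x + S x) x).re ≤ -‖x‖ ^ 2)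

include hR₀ hPA hS hq in
/-- The dissipation inequality for mild solutions. -/
theorem diniDeriv_mildSolution_le {κ₀ : ℝ}
    (hκ : Tendsto (inputConst hT hβ hB) (𝓝[>] 0) (𝓝 κ₀)) {M : ℝ} (hM0 : 0 ≤ M)
    (hM : ∀ t, ‖T t‖ ≤ M) {ε : ℝ} (hε : 0 < ε) (x : X) (u : LInf U) :
    diniDeriv (mildSolution T β B hB) (fun x => (inner ℂ (P x) x).re) u x ≤
      (((ε - 1) * ‖x‖ ^ 2 +
        (1 / (4 * ε) * (‖S‖ + ‖PA‖) ^ 2 * ‖(extrapInverse hT hβ R₀).comp B‖ ^ 2 * M ^ 2 +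
          M * ‖S‖ * ‖(extrapInverse hT hβ R₀).comp B‖ * κ₀) * ‖u‖ ^ 2 : ℝ) : EReal) := by
  set J := extrapInverse hT hβ R₀
  refine (diniDeriv_re_inner_le hT hPA hS hq hκ (a := M * ‖J.comp B‖) (fun t => ?_) hε).trans_eq ?_
  · obtain ⟨z, hz, hz'⟩ := exists_mildSolution_eq hB t x u
    have hbdd := isBddInput_coeFn_LInf u t
    -- Since `R₀ = -A⁻¹`, the vector `R₀ (-z)` is the `w` with `A w = z`.
    obtain ⟨h1, h2⟩ := generator_resolvent_zero hR₀ (-z)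
    rw [neg_neg] at h2
    refine ⟨⟨_, h1⟩, by rw [h2, hz], ?_, ?_⟩
    · change ‖R₀ (-z)‖ ≤ _
      rw [map_neg, ← conv_extrapInverse hT hβ hR₀ B hbdd hz']
      exact (norm_conv_le hM0 (fun s _ => hM s) hbdd.2).trans_eq (by ring)
    · rw [h2]
      exact norm_le_inputConst_mul hT hβ hB hz'
  · congr 1
    ring

include hT hβ hR₀ hPA hS hq in
theorem isNoncoerciveISSLyapunov_mildSolution
    (hpos : ∀ x : X, x ≠ 0 → 0 < (inner ℂ (P x) x).re) {M : ℝ} (hM0 : 0 ≤ M)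
    (hM : ∀ t, ‖T t‖ ≤ M) :
    IsNoncoerciveISSLyapunov (mildSolution T β B hB) (fun x => (inner ℂ (P x) x).re) := by
  obtain ⟨κ₀, hκ⟩ := exists_tendsto_inputConst hT hβ hB
  refine ⟨Complex.continuous_re.comp (by fun_prop), fun x => ?_, fun r => (‖P‖₊ + 1) * r ^ 2,
    fun r => (1 / 2) * r ^ 2, ?_⟩
  · rcases eq_or_ne x 0 with rfl | hx
    · simp
    · exact (hpos x hx).le
  -- This is `c(ε)` at `ε = 1/2`, which leaves the decay `-‖x‖²/2`. Adding `1` below keeps the gain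
  -- strictly increasing when `c` vanishes, as with `‖P‖ + 1` above.
  set c := 1 / (4 * (1 / 2)) * (‖S‖ + ‖PA‖) ^ 2 * ‖(extrapInverse hT hβ R₀).comp B‖ ^ 2 * M ^ 2 +
          M * ‖S‖ * ‖(extrapInverse hT hβ R₀).comp B‖ * κ₀ with hc
  refine ⟨fun r => (c.toNNReal + 1) * r ^ 2, isClassKInf_const_mul_sq (by positivity),
    isClassKInf_const_mul_sq (by positivity), (isClassKInf_const_mul_sq (by positivity)).1,
    fun x hx => ⟨hpos x hx, ?_⟩, fun x u => ?_⟩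
  · refine (re_inner_self_le P x).trans ?_
    push_cast
    gcongr
    exact le_add_of_nonneg_right zero_le_one
  · refine (diniDeriv_mildSolution_le hT hβ hB hR₀ hPA hS hq hκ hM0 hM one_half_pos x u).trans ?_
    rw [← hc, EReal.coe_le_coe_iff]
    push_cast
    have h1 : c * ‖u‖ ^ 2 ≤ (c.toNNReal + 1) * ‖u‖ ^ 2 := by
      gcongr
      exact (Real.le_coe_toNNReal c).trans (by simp)
    linarith

end Hilbert

end NoncoerciveISS

theorem mainTheorem3 {X U : Type*}
    [NormedAddCommGroup X] [InnerProductSpace ℂ X] [CompleteSpace X]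
    [NormedAddCommGroup U] [NormedSpace ℂ U] [CompleteSpace U]
    (T : ℝ≥0 → X →L[ℂ] X) (hT : IsC0Semigroup T)
    (A : X →ₗ.[ℂ] X) (hA : A = generator T)
    (P PA : X →L[ℂ] X)
    (hpos : ∀ x : X, x ≠ 0 → 0 < (inner ℂ (P x) x).re)
    (hdom : ∀ x : X, P x ∈ A†.domain)
    (hPA : ∀ x : A.domain, PA x = P (A x))
    (hLyap : ∀ x : A.domain,
      (inner ℂ (PA x + A† ⟨P x, hdom x⟩) (x : X)).re ≤ -‖(x : X)‖ ^ 2) :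
    -- the semigroup is exponentially stable, and `0` lies in the resolvent set of `A`
    (∃ M ω : ℝ, 0 < M ∧ 0 < ω ∧ ∀ t : ℝ≥0, ‖T t‖ ≤ M * Real.exp (-ω * t)) ∧
    (0 : ℂ) ∈ genResolventSet A ∧
    -- `S = A* P` is a bounded operator
    ∃ S : X →L[ℂ] X, (∀ x, S x = A† ⟨P x, hdom x⟩) ∧
    -- `X₋₁` may be formed with any `β` in the resolvent set, and `J = A₋₁⁻¹` exists
    ∀ β ∈ genResolventSet A, ∃ J : Extrapolation (generator T) β →L[ℂ] X,
      IsExtrapInverse T β J ∧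
      ∀ (B : U →L[ℂ] Extrapolation (generator T) β) (hB : IsInfAdmissible T β B),
        -- the quadratic function is a non-coercive ISS Lyapunov function
        IsNoncoerciveISSLyapunov (mildSolution T β B hB) (fun x => (inner ℂ (P x) x).re) ∧
        -- the dissipation inequality, with `κ t` the smallest constant and `κ₀ = κ(0+)`
        (∃ (κ : ℝ≥0 → ℝ) (κ₀ : ℝ),
          (∀ t, 0 < t → IsLeast {k | IsInputBound T β B t k} (κ t)) ∧
          Tendsto κ (𝓝[>] 0) (𝓝 κ₀) ∧
          ∀ M ω : ℝ, 0 < M → 0 < ω → (∀ t : ℝ≥0, ‖T t‖ ≤ M * Real.exp (-ω * t)) →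
            ∀ ε : ℝ, 0 < ε → ∀ (x : X) (u : LInf U),
              diniDeriv (mildSolution T β B hB) (fun x => (inner ℂ (P x) x).re) u x ≤
                (((ε - 1) * ‖x‖ ^ 2 +
                  (1 / (4 * ε) * (‖S‖ + ‖PA‖) ^ 2 * ‖J.comp B‖ ^ 2 * M ^ 2 +
                    M * ‖S‖ * ‖J.comp B‖ * κ₀) * ‖u‖ ^ 2 : ℝ) : EReal)) ∧
        -- input-to-state stability
        IsISS (mildSolution T β B hB) ∧
        -- if all mild solutions are continuous, they form a forward complete control system
        ((∀ (x : X) (u : LInf U), Continuous fun t => mildSolution T β B hB t x u) →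
          IsForwardComplete (mildSolution T β B hB)) := by
  subst hA
  have hdense := hT.dense_domain
  obtain ⟨S, hSeq⟩ := exists_adjoint_comp hdense hdom
  have hS : ∀ (x : X) (v : (generator T).domain),
      inner ℂ (S x) (v : X) = inner ℂ (P x) (generator T v) := fun x v => by
    rw [hSeq]
    exact LinearPMap.adjoint_isFormalAdjoint hdense ⟨P x, hdom x⟩ v
  have hq : ∀ x : X, (inner ℂ (PA x + S x) x).re ≤ -‖x‖ ^ 2 :=
    re_inner_le_of_domain hT fun x => by rw [hSeq]; exact hLyap x
  have hpos' : ∀ x : X, 0 ≤ (inner ℂ (P x) x).re := fun x => by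
    rcases eq_or_ne x 0 with rfl | hx
    · simp
    · exact (hpos x hx).le
  obtain ⟨τ, hτ0, hτ⟩ := exists_norm_le_half_of_integral_le hT (norm_nonneg P)
    (integral_sq_norm_orbit_le hT hPA hS hpos' hq)
  have hexp := exists_exponential_bound hT hτ0 hτ
  have h0 := hT.zero_mem_genResolventSet (hτ.trans_lt one_half_lt_one)
  obtain ⟨R₀, hR₀⟩ := id h0
  have hle : ∀ M ω : ℝ, 0 < M → 0 < ω → (∀ t : ℝ≥0, ‖T t‖ ≤ M * Real.exp (-ω * t)) →
      ∀ t, ‖T t‖ ≤ M := fun M ω hM hω h t => by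
    refine (h t).trans (mul_le_of_le_one_right hM.le (Real.exp_le_one_iff.2 ?_))
    have := mul_nonneg hω.le t.coe_nonneg
    linarith
  refine ⟨hexp, h0, S, hSeq, fun β hβ => ⟨extrapInverse hT hβ R₀,
    isExtrapInverse_extrapInverse hT hβ hR₀, fun B hB => ⟨?_, ?_,
      isISS_mildSolution hT hβ hB hτ0 hτ, isForwardComplete_mildSolution hT hβ hB⟩⟩⟩
  · obtain ⟨M, ω, hM, hω, h⟩ := hexp
    exact isNoncoerciveISSLyapunov_mildSolution hT hβ hB hR₀ hPA hS hq hpos hM.le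
      (hle M ω hM hω h)
  · obtain ⟨κ₀, hκ⟩ := exists_tendsto_inputConst hT hβ hB
    exact ⟨_, κ₀, fun t _ => isLeast_inputConst hT hβ hB t, hκ,
      fun M ω hM hω h ε hε x u => diniDeriv_mildSolution_le hT hβ hB hR₀ hPA hS hq hκ hM.le
        (hle M ω hM hω h) hε x u⟩
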